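/- For a finite poset $P$ let $\widetilde\chi(P)=\sum_{s}(-1)^{|s|-1}$, the sum over all chains $s$ of $P$ including the empty one, be its reduced Euler characteristic (so $\widetilde\chi(\emptyset)=-1$). For a prime power $q$ and integers $n,r\ge 1$ let $L_n^*(\mathbf F_q)$ be the poset of nonzero proper subspaces of $\mathbf F_q^n$, with its natural action of $GL_n(\mathbf F_q)$, and let $$\widetilde\chi_r(n,q)=\frac{1}{|GL_n(\mathbf F_q)|}\sum_{X\in \mathrm{Hom}(\mathbf Z^r,GL_n(\mathbf F_q))}\widetilde\chi\big(C_{L_n^*(\mathbf F_q)}(X(\mathbf Z^r))\big),$$ where $C_{L_n^*(\mathbf F_q)}(X(\mathbf Z^r))$ is the subposet of the $X(\mathbf Z^r)$-invariant subspaces. Then for every $r\ge 1$ there is a unique power series $F_r(x)=1+\sum_{n\ge1}a_{r,n}x^n\in\mathbf Z[q][[x]]$ whose coefficients $a_{r,n}\in\mathbf Z[q]$ take the value $\widetilde\chi_r(n,q)$ at every prime power $q$. Moreover, $(q-1)^{r-1}$ divides $F_r(x)-1$ in $\mathbf Z[q][[x]]$; that is, $(q-1)^{r-1}$ divides the polynomial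 $a_{r,n}$ (which is $\widetilde\chi_r(n,q)$ as a polynomial in $q$) in $\mathbf Z[q]$ for every $n\ge 1$. -/

import Mathlib

/-- The free abelian group `ℤ^r`, written multiplicatively. -/
abbrev FreeAbelianRank (r : ℕ) : Type := Fin r → Multiplicative ℤ

/-- A finite group admits only finitely many homomorphisms from `ℤ^r`. -/
instance finite_hom_freeAbelianRank (r : ℕ) (G : Type*) [Group G] [Finite G] :
    Finite (FreeAbelianRank r →* G) :=
  Finite.of_injective (β := Fin r → G)
    (fun X i => X (Pi.mulSingle i (Multiplicative.ofAdd 1))) fun X Y h =>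
      MonoidHom.pi_ext fun i z => DFunLike.congr_fun (MonoidHom.ext_mint
        (f := X.comp (MonoidHom.mulSingle (fun _ : Fin r => Multiplicative ℤ) i))
        (g := Y.comp (MonoidHom.mulSingle (fun _ : Fin r => Multiplicative ℤ) i)) (congrFun h i)) z

/-- The reduced Euler characteristic of (the order complex of) a finite poset `P`:
the sum of `(-1) ^ dim s` over all chains `s` of `P`, where `dim s = |s| - 1`. The empty chain, of
dimension `-1`, is included, so that the value is `-1 + ∑ (-1) ^ dim s` over the nonempty chains. -/
noncomputable def reducedEulerChar (P : Type*) [PartialOrder P] : ℤ :=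
  ∑ᶠ s : {s : Finset P // IsChain (· ≤ ·) (s : Set P)}, (-1) ^ (s.1.card + 1)

/-- `C_P(X(ℤ^r))`: the subposet of `P` fixed by the image of `X : ℤ^r → G`. -/
abbrev FixedSubposet {r : ℕ} {G : Type*} [Group G] (P : Type*) [PartialOrder P] [MulAction G P]
    (X : FreeAbelianRank r →* G) : Type _ :=
  {p : P // ∀ z : FreeAbelianRank r, X z • p = p}

/-- The `r`-th equivariant reduced Euler characteristic of a finite `G`-poset `P`, `G` a finite
group: `(1 / |G|) * ∑ χ̃(C_P(X(ℤ^r)))` over all homomorphisms `X : ℤ^r → G`. -/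
noncomputable def equivariantReducedEulerChar (r : ℕ) (P G : Type*) [PartialOrder P] [Group G]
    [MulAction G P] : ℚ :=
  (1 / (Nat.card G : ℚ)) *
    ∑ᶠ X : FreeAbelianRank r →* G, (reducedEulerChar (FixedSubposet P X) : ℚ)

/-- The poset of nonzero proper subspaces of the `K`-vector space `V`, ordered by inclusion. -/
abbrev ProperSubspace (K V : Type*) [Field K] [AddCommGroup V] [Module K V] : Type _ :=
  {U : Submodule K V // U ≠ ⊥ ∧ U ≠ ⊤}

/-- The image of a nonzero proper subspace under an element of `GL(V)` is nonzero and proper. -/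
theorem map_generalLinear_proper {K V : Type*} [Field K] [AddCommGroup V] [Module K V]
    (g : LinearMap.GeneralLinearGroup K V) (U : Submodule K V) (hU : U ≠ ⊥ ∧ U ≠ ⊤) :
    U.map (g : V →ₗ[K] V) ≠ ⊥ ∧ U.map (g : V →ₗ[K] V) ≠ ⊤ := by
  have e : U.map (g : V →ₗ[K] V) =
      U.map ((LinearMap.GeneralLinearGroup.toLinearEquiv g : V ≃ₗ[K] V) : V →ₗ[K] V) := rfl
  rw [e]
  exact ⟨fun h => hU.1 ((Submodule.map_eq_bot_iff).1 h),
    fun h => hU.2 ((Submodule.map_eq_top_iff).1 h)⟩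

/-- `GL(V)` acts on the poset of nonzero proper subspaces of `V` by taking images. -/
instance properSubspaceMulAction (K V : Type*) [Field K] [AddCommGroup V]
    [Module K V] : MulAction (LinearMap.GeneralLinearGroup K V) (ProperSubspace K V) where
  smul g U := ⟨U.1.map (g : V →ₗ[K] V), map_generalLinear_proper g U.1 U.2⟩
  one_smul U := Subtype.ext (Submodule.map_id U.1)
  mul_smul g h U := Subtype.ext (Submodule.map_comp (h : V →ₗ[K] V) (g : V →ₗ[K] V) U.1)

/-- `χ̃_r(n, q)`, computed over a field `K` with `q` elements: the `r`-th equivariant reduced Euler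
characteristic of the `GL_n(K)`-poset of nonzero proper subspaces of `K^n`. -/
noncomputable def chiTilde (r n : ℕ) (K : Type) [Field K] : ℚ :=
  equivariantReducedEulerChar r (ProperSubspace K (Fin n → K))
    (LinearMap.GeneralLinearGroup K (Fin n → K))

/-- `F = 1 + ∑_{n ≥ 1} χ̃_r(n, q) x ^ n` in `ℤ[q]⟦x⟧`: the constant coefficient is `1`, and for every
`n ≥ 1` the `n`-th coefficient is an integral polynomial in `q` whose value at each prime power
`q = |K|` is `χ̃_r(n, q)`. -/
def IsChiGeneratingFunction (r : ℕ) (F : PowerSeries (Polynomial ℤ)) : Prop :=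
  PowerSeries.coeff 0 F = 1 ∧
    ∀ n : ℕ, 1 ≤ n → ∀ (K : Type) [Field K] [Finite K],
      (((PowerSeries.coeff n F).eval (Nat.card K : ℤ) : ℤ) : ℚ) = chiTilde r n K

/-! For `n ≥ 1` the summand at `X` is the Möbius invariant `μ(0, V)` of the lattice of subspaces of
`V = K^n` stable under a commuting `r`-tuple of automorphisms. Let `f_r(n)` be the sum of these
invariants over all such tuples, divided by `|GL_n(K)|`, and let `F_r = ∑ f_r(n) x^n`. Everything
follows from `F_{r+1}(x) F_r(x) = F_r(qx)` for `r ≥ 0` and `F_1 = 1 - x`.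

For the recursion, sum the invariant in two ways over commuting tuples `(φ, g_1, …, g_r)` with `φ`
any endomorphism and the `g_i` invertible. For fixed `g`, the sum over `φ` is `|V|` times the
invariant of `g` (`sum_stableMoebius_insert`), which gives `q^n f_r(n)`. On the other hand, the
Fitting decomposition of `φ` splits `V`, and every stable subspace with it, into a part where `φ` is
invertible and a part where it is nilpotent. The invariant is multiplicative
(`stableMoebius_blockSum`), and on the nilpotent part only `φ = 0` contributes
(`sum_commutingTupleWithEnd_nilpotent`). This gives `∑ f_{r+1}(a) f_r(b)` over `a + b = n`.

The first evaluation is the heart. With `A` the commutative algebra generated by `g`, it says that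
the invariants of the `φ` in `End_A V` sum to `|V| μ(0, V)`, the last factor taken in the lattice of
`A`-submodules (`endMoebiusSum_eq`). If `A` has a nonzero nilpotent, all invariants vanish by
Weisner's theorem. Otherwise `V` is semisimple, and both sides, as functions `s` of a module,
satisfy `∑_U |Hom_A(V/U, V)| s(U) = 0` for `V ≠ 0`; this relation determines `s(V)` from the proper
submodules.

Over `ℤ[q]` the same recursion can be solved because the constant terms are `1`. Since `F_{r+1} - 1
= (F_r(qx) - F_r(x)) / F_r(x)`, and the numerator has coefficients `(q^n - 1) a_{r,n}`, each step
gains a factor `q - 1`. -/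

section FiniteSums

/-! ### Rearranging finite sums -/

theorem finsum_sigma_of_finite {α : Type*} {β : α → Type*} [Finite α] [∀ a, Finite (β a)]
    {M : Type*} [AddCommMonoid M] (f : (Σ a, β a) → M) :
    ∑ᶠ p, f p = ∑ᶠ a, ∑ᶠ b, f ⟨a, b⟩ := by
  classical
  have := Fintype.ofFinite α
  have := fun a => Fintype.ofFinite (β a)
  simp only [finsum_eq_sum_of_fintype]
  exact Fintype.sum_sigma f

theorem finsum_prod_of_finite {α β : Type*} [Finite α] [Finite β]
    {M : Type*} [AddCommMonoid M] (f : α × β → M) :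
    ∑ᶠ p, f p = ∑ᶠ a, ∑ᶠ b, f (a, b) := finsum_curry f (Set.toFinite _)

theorem finsum_fiberwise {α γ : Type*} [Finite α] [Finite γ] {M : Type*} [AddCommMonoid M]
    (g : α → γ) (f : α → M) :
    ∑ᶠ a, f a = ∑ᶠ c, ∑ᶠ a : {a // g a = c}, f a := by
  rw [← finsum_sigma_of_finite (fun p : Σ c, {a // g a = c} => f p.2)]
  exact (finsum_comp_equiv (Equiv.sigmaFiberEquiv g) (f := f)).symm

theorem finsum_const_of_finite {α : Type*} [Finite α] {M : Type*} [AddCommMonoid M] (c : M) :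
    ∑ᶠ _ : α, c = Nat.card α • c := by
  classical
  have := Fintype.ofFinite α
  rw [finsum_eq_sum_of_fintype, Finset.sum_const, Nat.card_eq_fintype_card, Finset.card_univ]

theorem mul_finsum_of_finite {α : Type*} [Finite α] {R : Type*} [Semiring R] (c : R) (f : α → R) :
    c * ∑ᶠ a, f a = ∑ᶠ a, c * f a := by
  classical
  have := Fintype.ofFinite α
  simp only [finsum_eq_sum_of_fintype, Finset.mul_sum]

theorem finsum_mul_of_finite {α : Type*} [Finite α] {R : Type*} [Semiring R] (c : R) (f : α → R) :
    (∑ᶠ a, f a) * c = ∑ᶠ a, f a * c := by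
  classical
  have := Fintype.ofFinite α
  simp only [finsum_eq_sum_of_fintype, Finset.sum_mul]

theorem finsum_option_of_finite {α : Type*} [Finite α] {M : Type*} [AddCommMonoid M]
    (f : Option α → M) :
    ∑ᶠ a, f a = f none + ∑ᶠ a, f (some a) := by
  classical
  have := Fintype.ofFinite α
  simp only [finsum_eq_sum_of_fintype, Fintype.sum_option]

theorem finsum_subtype_add_subtype_not {α : Type*} [Finite α] {M : Type*} [AddCommMonoid M]
    (p : α → Prop) (f : α → M) :
    ∑ᶠ a, f a = ∑ᶠ a : {a // p a}, f a + ∑ᶠ a : {a // ¬ p a}, f a := by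
  classical
  have := Fintype.ofFinite α
  simp only [finsum_eq_sum_of_fintype]
  rw [← Fintype.sum_subtype_add_sum_subtype p f]

/-- Two double sums over the same relation agree. -/
theorem finsum_subtype_comm {α β : Type*} [Finite α] [Finite β] {M : Type*} [AddCommMonoid M]
    (r : α → β → Prop) (f : α → β → M) :
    ∑ᶠ a, ∑ᶠ b : {b // r a b}, f a b = ∑ᶠ b, ∑ᶠ a : {a // r a b}, f a b := by
  rw [← finsum_sigma_of_finite (fun p : Σ a, {b // r a b} => f p.1 p.2),
    ← finsum_sigma_of_finite (fun p : Σ b, {a // r a b} => f p.2 p.1)]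
  exact finsum_eq_of_bijective (fun p => ⟨p.2.1, p.1, p.2.2⟩)
    ⟨Function.LeftInverse.injective (g := fun p => ⟨p.2.1, p.1, p.2.2⟩) fun _ => rfl,
      by rintro ⟨b, a, h⟩; exact ⟨⟨a, b, h⟩, rfl⟩⟩ (fun _ => rfl)

end FiniteSums

/-! ### Reduced Euler characteristics of finite posets -/

section EulerCharacteristic

/-- Chains depend only on the comparability relation, so `e` need not be monotone; this form also
covers order duals. -/
theorem reducedEulerChar_congr {P Q : Type*} [PartialOrder P] [PartialOrder Q] (e : P ≃ Q)
    (h : ∀ x y, (x ≤ y ∨ y ≤ x) ↔ (e x ≤ e y ∨ e y ≤ e x)) :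
    reducedEulerChar P = reducedEulerChar Q := by
  refine finsum_eq_of_bijective
    (fun s => ⟨s.1.map e.toEmbedding, ?_⟩) ⟨?_, ?_⟩ ?_
  · intro x hx y hy hxy
    simp only [Finset.coe_map, Set.mem_image, Finset.mem_coe, Equiv.coe_toEmbedding] at hx hy
    obtain ⟨x, hx, rfl⟩ := hx
    obtain ⟨y, hy, rfl⟩ := hy
    exact (h x y).1 (s.2 hx hy (fun h => hxy (by rw [h])))
  · intro s t hst
    exact Subtype.ext (Finset.map_injective _ (congrArg Subtype.val hst))
  · intro s
    refine ⟨⟨s.1.map e.symm.toEmbedding, ?_⟩, ?_⟩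
    · intro x hx y hy hxy
      simp only [Finset.coe_map, Set.mem_image, Finset.mem_coe, Equiv.coe_toEmbedding] at hx hy
      obtain ⟨x, hx, rfl⟩ := hx
      obtain ⟨y, hy, rfl⟩ := hy
      rw [h]
      simpa using s.2 hx hy (fun h => hxy (by rw [h]))
    · apply Subtype.ext
      simp [Finset.map_map]
  · intro s
    simp

theorem reducedEulerChar_orderIso {P Q : Type*} [PartialOrder P] [PartialOrder Q] (e : P ≃o Q) :
    reducedEulerChar P = reducedEulerChar Q :=
  reducedEulerChar_congr e.toEquiv (by simp)

/-- Chains are grouped by their largest element. -/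
theorem reducedEulerChar_eq_sum_Iio (P : Type*) [PartialOrder P] [Finite P] :
    reducedEulerChar P = -1 - ∑ᶠ x : P, reducedEulerChar (Set.Iio x) := by
  classical
  let C (Q : Type _) [PartialOrder Q] := {s : Finset Q // IsChain (· ≤ ·) (s : Set Q)}
  -- `none` gives the empty chain. Any other chain is its largest element `x` together with a chain
  -- strictly below `x`, and adjoining `x` flips the sign.
  let F : Option (Σ x : P, C (Set.Iio x)) → C P := fun o => match o with
    | none => ⟨∅, by simp⟩
    | some ⟨x, s⟩ => ⟨insert x (s.1.map (Function.Embedding.subtype _)), by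
        rw [Finset.coe_insert]
        refine IsChain.insert ?_ ?_
        · intro a ha b hb hab
          simp only [Finset.coe_map, Set.mem_image, Finset.mem_coe] at ha hb
          obtain ⟨a, ha, rfl⟩ := ha
          obtain ⟨b, hb, rfl⟩ := hb
          exact s.2 ha hb (fun h => hab (by rw [h]))
        · intro b hb _
          simp only [Finset.coe_map, Set.mem_image, Finset.mem_coe] at hb
          obtain ⟨b, hb, rfl⟩ := hb
          exact Or.inr b.2.le⟩
  have hnot : ∀ (x : P) (s : C (Set.Iio x)),
      x ∉ s.1.map (Function.Embedding.subtype _) := by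
    intro x s hx
    simp only [Finset.mem_map] at hx
    obtain ⟨b, _, hb⟩ := hx
    exact absurd hb (ne_of_lt b.2)
  have hle : ∀ (x : P) (s : C (Set.Iio x)) (y : P), y ∈ (F (some ⟨x, s⟩)).1 → y ≤ x := by
    intro x s y hy
    simp only [F, Finset.mem_insert, Finset.mem_map] at hy
    rcases hy with rfl | ⟨b, _, rfl⟩
    · exact le_rfl
    · exact b.2.le
  have hmem : ∀ (x : P) (s : C (Set.Iio x)), x ∈ (F (some ⟨x, s⟩)).1 := by
    intro x s
    simp [F]
  have hF : Function.Bijective F := by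
    constructor
    · rintro (_ | ⟨x, s⟩) (_ | ⟨y, t⟩) h
      · rfl
      · have := hmem y t
        rw [← h] at this
        simp [F] at this
      · have := hmem x s
        rw [h] at this
        simp [F] at this
      · have h1 : x = y := le_antisymm (hle y t x (h ▸ hmem x s)) (hle x s y (h ▸ hmem y t))
        subst h1
        have h2 : insert x (s.1.map (Function.Embedding.subtype _)) =
          insert x (t.1.map (Function.Embedding.subtype _)) := congrArg Subtype.val h
        have h3 := congrArg (fun u => u.erase x) h2
        simp only [Finset.erase_insert (hnot x s), Finset.erase_insert (hnot x t)] at h3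
        have h4 := Finset.map_injective _ h3
        rw [Subtype.ext h4]
    · rintro ⟨s, hs⟩
      rcases s.eq_empty_or_nonempty with rfl | hne
      · exact ⟨none, rfl⟩
      · obtain ⟨x, hx⟩ := s.exists_maximal hne
        have hlt : ∀ y ∈ s, y ≠ x → y < x := fun y hy hyx =>
          (lt_of_le_of_ne ((hs hy hx.1 hyx).elim id (fun h => hx.2 hy h)) hyx)
        refine ⟨some ⟨x, ⟨s.subtype (· ∈ Set.Iio x), ?_⟩⟩, ?_⟩
        · intro a ha b hb hab
          simp only [Finset.mem_coe, Finset.mem_subtype] at ha hb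
          exact hs ha hb (fun h => hab (Subtype.ext h))
        · apply Subtype.ext
          ext y
          simp only [F, Finset.mem_insert, Finset.mem_map, Finset.mem_subtype]
          constructor
          · rintro (rfl | ⟨b, hb, rfl⟩)
            · exact hx.1
            · exact hb
          · intro hy
            by_cases hyx : y = x
            · exact Or.inl hyx
            · exact Or.inr ⟨⟨y, hlt y hy hyx⟩, hy, rfl⟩
  unfold reducedEulerChar
  rw [← finsum_comp F hF, finsum_option_of_finite, finsum_sigma_of_finite, sub_eq_add_neg,
    ← finsum_neg_distrib]
  congr 1
  · refine finsum_congr fun x => ?_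
    rw [← finsum_neg_distrib]
    refine finsum_congr fun s => ?_
    simp only [F]
    rw [Finset.card_insert_of_notMem (hnot x s), Finset.card_map, pow_succ]
    simp

end EulerCharacteristic

/-! ### Möbius functions and Weisner's theorem -/

section Moebius

/-- The Möbius function of a finite poset, as the reduced Euler characteristic of the open
interval. -/
noncomputable def moebius {L : Type*} [PartialOrder L] (a b : L) : ℤ :=
  open Classical in if a = b then 1 else reducedEulerChar (Set.Ioo a b)

@[simp] theorem moebius_self {L : Type*} [PartialOrder L] (a : L) : moebius a a = 1 := by
  simp [moebius]

theorem moebius_of_ne {L : Type*} [PartialOrder L] {a b : L} (h : a ≠ b) :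
    moebius a b = reducedEulerChar (Set.Ioo a b) := by
  simp [moebius, h]

/-- The Möbius function only depends on the interval. -/
theorem moebius_map {L L' : Type*} [PartialOrder L] [PartialOrder L'] (f : L ↪o L') (a b : L)
    (h : ∀ y, f a ≤ y → y ≤ f b → y ∈ Set.range f) : moebius (f a) (f b) = moebius a b := by
  by_cases hab : a = b
  · subst hab; simp
  rw [moebius_of_ne hab, moebius_of_ne (fun h => hab (f.injective h))]
  refine (reducedEulerChar_congr (Equiv.ofBijective
    (fun x : Set.Ioo a b => (⟨f x, f.lt_iff_lt.2 x.2.1, f.lt_iff_lt.2 x.2.2⟩ :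
      Set.Ioo (f a) (f b))) ⟨?_, ?_⟩) ?_).symm
  · intro x y hxy
    exact Subtype.ext (f.injective (congrArg Subtype.val hxy))
  · rintro ⟨y, hy⟩
    obtain ⟨x, rfl⟩ := h y hy.1.le hy.2.le
    exact ⟨⟨x, f.lt_iff_lt.1 hy.1, f.lt_iff_lt.1 hy.2⟩, rfl⟩
  · intro x y
    exact or_congr (f.le_iff_le (a := x.1) (b := y.1)).symm
      (f.le_iff_le (a := y.1) (b := x.1)).symm

theorem moebius_orderIso {L L' : Type*} [PartialOrder L] [PartialOrder L'] (f : L ≃o L')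
    (a b : L) : moebius (f a) (f b) = moebius a b :=
  moebius_map f.toOrderEmbedding a b (fun y _ _ => f.surjective y)

theorem moebius_dual {L : Type*} [PartialOrder L] (a b : L) :
    moebius (OrderDual.toDual b) (OrderDual.toDual a) = moebius a b := by
  by_cases hab : a = b
  · subst hab; simp
  rw [moebius_of_ne hab, moebius_of_ne (fun h => hab (OrderDual.toDual.injective h).symm)]
  exact reducedEulerChar_congr
    { toFun := fun x => ⟨OrderDual.ofDual x.1, x.2.2, x.2.1⟩
      invFun := fun x => ⟨OrderDual.toDual x.1, x.2.2, x.2.1⟩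
      left_inv := fun _ => rfl
      right_inv := fun _ => rfl } (fun x y => or_comm)

/-- Grouping the chains of the open interval by largest element yields the usual defining recursion
of the Möbius function. -/
theorem sum_moebius_left {L : Type*} [PartialOrder L] [Finite L] {a b : L} (h : a < b) :
    ∑ᶠ x : Set.Icc a b, moebius a (x : L) = 0 := by
  classical
  have key := reducedEulerChar_eq_sum_Iio (Set.Ioo a b)
  let F : Option (Option (Set.Ioo a b)) → Set.Icc a b := fun o => match o with
    | none => ⟨b, h.le, le_rfl⟩
    | some none => ⟨a, le_rfl, h.le⟩
    | some (some x) => ⟨x, x.2.1.le, x.2.2.le⟩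
  have hF : Function.Bijective F := by
    constructor
    · rintro (_ | _ | ⟨x, hx⟩) (_ | _ | ⟨y, hy⟩) e <;> replace e := congrArg Subtype.val e <;>
        simp only [F, Option.some.injEq, reduceCtorEq, Subtype.mk.injEq] at e ⊢
      · exact absurd e h.ne'
      · exact absurd e hy.2.ne'
      · exact absurd e h.ne
      · exact absurd e hy.1.ne
      · exact absurd e hx.2.ne
      · exact absurd e hx.1.ne'
      · exact e
    · rintro ⟨x, hx⟩
      by_cases h1 : x = b
      · exact ⟨none, Subtype.ext h1.symm⟩
      by_cases h2 : x = a
      · exact ⟨some none, Subtype.ext h2.symm⟩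
      exact ⟨some (some ⟨x, lt_of_le_of_ne hx.1 (Ne.symm h2), lt_of_le_of_ne hx.2 h1⟩), rfl⟩
  rw [← finsum_comp F hF, finsum_option_of_finite, finsum_option_of_finite]
  simp only [F, moebius_self]
  rw [moebius_of_ne h.ne, key]
  have : ∀ x : Set.Ioo a b, reducedEulerChar (Set.Iio x) = moebius a (x : L) := by
    intro x
    rw [moebius_of_ne x.2.1.ne]
    exact reducedEulerChar_congr
      { toFun := fun y => ⟨y.1.1, y.1.2.1, y.2⟩
        invFun := fun y => ⟨⟨y.1, y.2.1, y.2.2.trans x.2.2⟩, y.2.2⟩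
        left_inv := fun _ => rfl
        right_inv := fun _ => rfl } (fun y z => Iff.rfl)
  simp only [this]
  ring

theorem sum_moebius_right {L : Type*} [PartialOrder L] [Finite L] {a b : L} (h : a < b) :
    ∑ᶠ x : Set.Icc a b, moebius (x : L) b = 0 := by
  rw [← sum_moebius_left (L := Lᵒᵈ) (a := OrderDual.toDual b) (b := OrderDual.toDual a) h]
  exact finsum_eq_of_bijective (fun x => ⟨OrderDual.toDual x.1, x.2.2, x.2.1⟩)
    ⟨fun x y e => Subtype.ext (by simpa using Subtype.ext_iff.1 e),
      fun x => ⟨⟨OrderDual.ofDual x.1, x.2.2, x.2.1⟩, rfl⟩⟩ (fun x => (moebius_dual _ _).symm)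

/-- Induction on `b`: both sides sum to zero over `[a, b]` when `a < b`, and they agree below `b`.
The restriction `a ≤ b` matters, since `moebius` takes the value `-1`, not `0`, on distinct `a`, `b`
with `a ≤ b` false. -/
theorem moebius_prod {L L' : Type*} [PartialOrder L] [PartialOrder L'] [Finite L] [Finite L']
    (a : L × L') : ∀ b : L × L', a ≤ b →
      moebius a b = moebius a.1 b.1 * moebius a.2 b.2 := by
  intro b
  induction b using WellFoundedLT.induction with
  | _ b ih =>
  intro hab
  rcases eq_or_lt_of_le hab with rfl | hlt
  · simp
  have h1 := sum_moebius_left hlt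
  have e : Function.Bijective (fun p : Set.Icc a.1 b.1 × Set.Icc a.2 b.2 =>
      (⟨(p.1.1, p.2.1), ⟨p.1.2.1, p.2.2.1⟩, ⟨p.1.2.2, p.2.2.2⟩⟩ : Set.Icc a b)) := by
    constructor
    · rintro ⟨⟨x, hx⟩, ⟨y, hy⟩⟩ ⟨⟨x', hx'⟩, ⟨y', hy'⟩⟩ h
      have h' := congrArg Subtype.val h
      simp only [Prod.mk.injEq] at h'
      obtain ⟨rfl, rfl⟩ := h'
      rfl
    · rintro ⟨⟨x, y⟩, ⟨h1, h2⟩, ⟨h3, h4⟩⟩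
      exact ⟨(⟨x, h1, h3⟩, ⟨y, h2, h4⟩), rfl⟩
  have h2 : ∑ᶠ x : Set.Icc a b, moebius a.1 x.1.1 * moebius a.2 x.1.2 = 0 := by
    rw [← finsum_comp _ e, finsum_prod_of_finite]
    simp only
    have : ∀ x : Set.Icc a.1 b.1, ∑ᶠ y : Set.Icc a.2 b.2, moebius a.1 x.1 * moebius a.2 y.1 =
        moebius a.1 x.1 * ∑ᶠ y : Set.Icc a.2 b.2, moebius a.2 y.1 :=
      fun x => (mul_finsum_of_finite _ _).symm
    simp only [this]
    rw [← finsum_mul_of_finite]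
    rcases eq_or_lt_of_le hab.1 with h | h
    · rcases eq_or_lt_of_le hab.2 with h' | h'
      · exact absurd (Prod.ext h h') hlt.ne
      · rw [sum_moebius_left h', mul_zero]
    · rw [sum_moebius_left h, zero_mul]
  classical
  have := Fintype.ofFinite (Set.Icc a b)
  rw [finsum_eq_sum_of_fintype] at h1 h2
  have hb : b ∈ Set.Icc a b := ⟨hab, le_rfl⟩
  rw [← Finset.sum_erase_add _ _ (Finset.mem_univ (⟨b, hb⟩ : Set.Icc a b))] at h1 h2
  have h3 : ∑ x ∈ Finset.univ.erase (⟨b, hb⟩ : Set.Icc a b), moebius a (x : L × L') =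
      ∑ x ∈ Finset.univ.erase (⟨b, hb⟩ : Set.Icc a b), moebius a.1 x.1.1 * moebius a.2 x.1.2 := by
    refine Finset.sum_congr rfl fun x hx => ih x.1 ?_ x.2.1
    exact lt_of_le_of_ne x.2.2 (fun h => (Finset.ne_of_mem_erase hx) (Subtype.ext h))
  simp only at h1 h2
  linarith

/-- Weisner's theorem. -/
theorem sum_moebius_inf_eq {L : Type*} [Lattice L] [BoundedOrder L] [Finite L] {c : L}
    (hc : c ≠ ⊤) : ∀ y : L, y ≤ c → ∑ᶠ x : {x : L // x ⊓ c = y}, moebius x.1 ⊤ = 0 := by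
  intro y
  induction y using WellFoundedGT.induction with
  | _ y ih =>
  intro hy
  -- Sort the elements `x ≥ y` by `z = x ⊓ c`, which lies between `y` and `c`. The classes with `z >
  -- y` sum to zero by downward induction, so the class `z = y` does too.
  have h1 := sum_moebius_right (lt_of_le_of_lt hy (lt_top_iff_ne_top.2 hc))
  rw [finsum_fiberwise (fun x : Set.Icc y ⊤ => x.1 ⊓ c)] at h1
  rw [finsum_eq_single _ y] at h1
  · rw [← h1]
    refine finsum_eq_of_bijective (fun x => ⟨⟨x.1, x.2.symm.le.trans inf_le_left, le_top⟩, x.2⟩)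
      ⟨?_, ?_⟩ (fun _ => rfl)
    · intro x x' h
      simpa [Subtype.ext_iff] using h
    · rintro ⟨⟨x, hx⟩, h⟩
      exact ⟨⟨x, h⟩, rfl⟩
  · intro z hz
    by_cases hyz : y ≤ z ∧ z ≤ c
    · rw [← ih z (lt_of_le_of_ne hyz.1 (Ne.symm hz)) hyz.2]
      refine finsum_eq_of_bijective (fun x => ⟨x.1.1, x.2⟩) ⟨?_, ?_⟩ (fun _ => rfl)
      · intro x x' h
        simpa [Subtype.ext_iff] using h
      · rintro ⟨x, h⟩
        exact ⟨⟨⟨x, hyz.1.trans (h ▸ inf_le_left), le_top⟩, h⟩, rfl⟩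
    · have : IsEmpty {x : Set.Icc y ⊤ // x.1 ⊓ c = z} := by
        refine ⟨fun x => hyz ?_⟩
        rw [← x.2]
        exact ⟨le_inf x.1.2.1 hy, inf_le_right⟩
      exact finsum_of_isEmpty _

/-- Under this hypothesis the Weisner sum for `c` at `⊥` has the single term `x = ⊥`. -/
theorem moebius_eq_zero_of_inf_ne_bot {L : Type*} [Lattice L] [BoundedOrder L] [Finite L] {c : L}
    (hc : c ≠ ⊤) (h : ∀ x : L, x ≠ ⊥ → x ⊓ c ≠ ⊥) : moebius (⊥ : L) ⊤ = 0 := by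
  rw [← sum_moebius_inf_eq hc ⊥ bot_le]
  rw [finsum_eq_single _ (⟨⊥, bot_inf_eq c⟩ : {x : L // x ⊓ c = ⊥})]
  intro b hb
  exact absurd b.2 (h b.1 (fun h' => hb (Subtype.ext h')))

end Moebius

/-! ### Lattices of stable submodules -/

section StableSubmodules

variable {R M : Type*} [Ring R] [AddCommGroup M] [Module R M]

/-- The lattice of submodules stable under a set of endomorphisms. -/
def stableSubmodules (T : Set (Module.End R M)) : Sublattice (Submodule R M) where
  carrier := {U | ∀ f ∈ T, U ≤ U.comap f}
  supClosed' _ hU _ hV f hf := sup_le ((hU f hf).trans (Submodule.comap_mono le_sup_left))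
    ((hV f hf).trans (Submodule.comap_mono le_sup_right))
  infClosed' _ hU _ hV f hf := le_inf (inf_le_left.trans (hU f hf)) (inf_le_right.trans (hV f hf))

theorem mem_stableSubmodules {T : Set (Module.End R M)} {U : Submodule R M} :
    U ∈ stableSubmodules T ↔ ∀ f ∈ T, ∀ u ∈ U, f u ∈ U := Iff.rfl

instance (T : Set (Module.End R M)) : BoundedOrder (stableSubmodules T) where
  top := ⟨⊤, fun _ _ _ _ => trivial⟩
  le_top U := le_top (a := U.1)
  bot := ⟨⊥, fun _ _ => bot_le⟩
  bot_le U := bot_le (a := U.1)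

/-- The Möbius invariant `μ(0, M)` of the lattice of submodules of `M` stable under `T`. -/
noncomputable def stableMoebius (T : Set (Module.End R M)) : ℤ :=
  moebius (⊥ : stableSubmodules T) ⊤

instance finite_linearMap {R M M' : Type*} [Semiring R] [AddCommMonoid M] [AddCommMonoid M']
    [Module R M] [Module R M'] [Finite M] [Finite M'] : Finite (M →ₗ[R] M') :=
  DFunLike.finite _

instance finite_moduleEnd {R M : Type*} [Semiring R] [AddCommMonoid M] [Module R M] [Finite M] :
    Finite (Module.End R M) := finite_linearMap

theorem stableMoebius_of_subsingleton [Subsingleton M] (T : Set (Module.End R M)) :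
    stableMoebius T = 1 := by
  have : (⊥ : stableSubmodules T) = ⊤ := Subtype.ext (Subsingleton.elim _ _)
  rw [stableMoebius, this, moebius_self]

theorem stableMoebius_empty : stableMoebius (∅ : Set (Module.End R M)) =
    moebius (⊥ : Submodule R M) ⊤ := by
  refine (moebius_map (OrderEmbedding.subtype fun U => U ∈ stableSubmodules
    (∅ : Set (Module.End R M))) ⊥ ⊤ ?_).symm
  intro U _ _
  exact ⟨⟨U, fun f hf => absurd hf (Set.notMem_empty f)⟩, rfl⟩

theorem stableMoebius_congr {M' : Type*} [AddCommGroup M'] [Module R M'] (e : M ≃ₗ[R] M')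
    {T : Set (Module.End R M)} {T' : Set (Module.End R M')}
    (h : ∀ f ∈ T, ∃ g ∈ T', ∀ m, e (f m) = g (e m))
    (h' : ∀ g ∈ T', ∃ f ∈ T, ∀ m, e (f m) = g (e m)) :
    stableMoebius T = stableMoebius T' := by
  have hmem : ∀ U : Submodule R M,
      U ∈ stableSubmodules T ↔ Submodule.orderIsoMapComap e U ∈ stableSubmodules T' := by
    intro U
    simp only [mem_stableSubmodules, Submodule.orderIsoMapComap_apply, Submodule.mem_map]
    constructor
    · rintro hU g hg _ ⟨u, hu, rfl⟩
      obtain ⟨f, hf, hfg⟩ := h' g hg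
      exact ⟨f u, hU f hf u hu, hfg u⟩
    · intro hU f hf u hu
      obtain ⟨g, hg, hfg⟩ := h f hf
      obtain ⟨u', hu', e'⟩ := hU g hg (e u) ⟨u, hu, rfl⟩
      have : u' = f u := e.injective (e'.trans (hfg u).symm)
      rwa [← this]
  let F : stableSubmodules T ≃o stableSubmodules T' :=
    { toEquiv := (Submodule.orderIsoMapComap e).toEquiv.subtypeEquiv hmem
      map_rel_iff' := fun {U V} => (Submodule.orderIsoMapComap e).le_iff_le (x := U.1) (y := V.1) }
  rw [stableMoebius, stableMoebius, ← moebius_orderIso F, map_bot, map_top]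

/-- Weisner's theorem applies with `c = ker a`, which is stable because `a` commutes with `T`. A
stable `U` meeting `ker a` trivially has `a` injective on it, so it is zero because `a` is
nilpotent. -/
theorem stableMoebius_eq_zero_of_isNilpotent [Finite M] {T : Set (Module.End R M)}
    {a : Module.End R M} (ha : IsNilpotent a) (h0 : a ≠ 0) (hT : ∀ f ∈ T, Commute f a)
    (hU : ∀ U ∈ stableSubmodules T, ∀ u ∈ U, a u ∈ U) : stableMoebius T = 0 := by
  have hc : LinearMap.ker a ∈ stableSubmodules T := by
    intro f hf u hu
    have := LinearMap.congr_fun (hT f hf) u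
    simp only [Module.End.mul_apply] at this
    rw [LinearMap.mem_ker] at hu
    rw [Submodule.mem_comap, LinearMap.mem_ker, ← this, hu, map_zero]
  refine moebius_eq_zero_of_inf_ne_bot (c := (⟨LinearMap.ker a, hc⟩ : stableSubmodules T)) ?_ ?_
  · intro h
    exact h0 (LinearMap.ker_eq_top.1 (congrArg Subtype.val h))
  · intro x hx h
    apply hx
    have h' : x.1 ⊓ LinearMap.ker a = ⊥ := congrArg Subtype.val h
    have key : ∀ k, ∀ u ∈ x.1, (a ^ k) u = 0 → u = 0 := by
      intro k
      induction k with
      | zero => intro u _ h; simpa using h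
      | succ k ih =>
        intro u hu h
        rw [pow_succ, Module.End.mul_apply] at h
        have h1 := ih (a u) (hU x.1 x.2 u hu) h
        have h2 : u ∈ x.1 ⊓ LinearMap.ker a := ⟨hu, h1⟩
        rw [h'] at h2
        simpa using h2
    obtain ⟨n, hn⟩ := ha
    refine Subtype.ext ((Submodule.eq_bot_iff _).2 fun u hu => key n u hu ?_)
    rw [hn, LinearMap.zero_apply]

theorem stableMoebius_eq_moebius_of_restrict {T : Set (Module.End R M)} (U : stableSubmodules T)
    {T' : Set (Module.End R U.1)} (h : ∀ f ∈ T, ∃ g ∈ T', ∀ u : U.1, f u = g u)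
    (h' : ∀ g ∈ T', ∃ f ∈ T, ∀ u : U.1, f u = g u) :
    stableMoebius T' = moebius ⊥ U := by
  have hmem : ∀ W : Submodule R U.1,
      W ∈ stableSubmodules T' ↔ W.map U.1.subtype ∈ stableSubmodules T := by
    intro W
    simp only [mem_stableSubmodules]
    constructor
    · rintro hW f hf u ⟨w, hw, rfl⟩
      obtain ⟨g, hg, hfg⟩ := h f hf
      exact ⟨g w, hW g hg w hw, (hfg w).symm⟩
    · intro hW g hg w hw
      obtain ⟨f, hf, hfg⟩ := h' g hg
      obtain ⟨w', hw', e⟩ := hW f hf w ⟨w, hw, rfl⟩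
      replace e := e.trans (hfg w)
      rwa [← Subtype.ext e]
  let F : stableSubmodules T' ↪o stableSubmodules T :=
    { toFun := fun W => ⟨W.1.map U.1.subtype, (hmem W.1).1 W.2⟩
      inj' := fun W W' e => Subtype.ext
        (Submodule.map_injective_of_injective U.1.subtype_injective (congrArg Subtype.val e))
      map_rel_iff' := fun {W W'} =>
        Submodule.map_le_map_iff_of_injective U.1.subtype_injective W.1 W'.1 }
  have hb : F ⊥ = ⊥ := Subtype.ext (Submodule.map_bot _)
  have ht : F ⊤ = U := Subtype.ext (Submodule.map_subtype_top _)
  rw [stableMoebius, ← moebius_map F ⊥ ⊤, hb, ht]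
  intro y _ hy
  rw [ht] at hy
  have e : (y.1.comap U.1.subtype).map U.1.subtype = y.1 := by
    rw [Submodule.map_comap_subtype]
    exact inf_eq_right.2 hy
  exact ⟨⟨y.1.comap U.1.subtype, (hmem _).2 (e.symm ▸ y.2)⟩, Subtype.ext e⟩

theorem moebius_bot_top_submodule (U : Submodule R M) :
    moebius (⊥ : Submodule R U) ⊤ = moebius ⊥ U := by
  rw [← moebius_map (Submodule.MapSubtype.orderEmbedding U) ⊥ ⊤]
  · simp
  · intro y _ hy
    refine ⟨y.comap U.subtype, ?_⟩
    simp at hy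
    simpa using hy

theorem sum_moebius_bot {L : Type*} [PartialOrder L] [BoundedOrder L] [Finite L]
    (h : (⊥ : L) ≠ ⊤) : ∑ᶠ x : L, moebius ⊥ x = 0 := by
  rw [← sum_moebius_left (bot_lt_iff_ne_bot.2 h.symm)]
  exact finsum_eq_of_bijective (fun x => ⟨x, bot_le, le_top⟩)
    ⟨fun x y e => by simpa using Subtype.ext_iff.1 e, fun x => ⟨x.1, rfl⟩⟩ fun _ => rfl

end StableSubmodules

/-! ### Counting homomorphisms and complements -/

section Counting

variable {A N : Type*} [Ring A] [AddCommGroup N] [Module A N]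

theorem card_sup_of_disjoint {W X : Submodule A N} (h : Disjoint W X) :
    Nat.card (W ⊔ X : Submodule A N) = Nat.card W * Nat.card X := by
  rw [← Nat.card_prod]
  refine (Nat.card_eq_of_bijective (fun p : W × X => (⟨p.1 + p.2,
    Submodule.add_mem_sup p.1.2 p.2.2⟩ : (W ⊔ X : Submodule A N))) ⟨?_, ?_⟩).symm
  · rintro ⟨w, x⟩ ⟨w', x'⟩ e
    have e' : (w : N) + x = w' + x' := congrArg Subtype.val e
    have := Submodule.disjoint_def.1 h (w - w' : N) (W.sub_mem w.2 w'.2)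
      (by rw [sub_eq_sub_iff_add_eq_add.2 (e'.trans (add_comm _ _))]
          exact X.sub_mem x'.2 x.2)
    have hw : (w : N) = w' := sub_eq_zero.1 this
    rw [hw, add_right_inj] at e'
    exact Prod.ext (Subtype.ext hw) (Subtype.ext e')
  · rintro ⟨u, hu⟩
    obtain ⟨w, hw, x, hx, rfl⟩ := Submodule.mem_sup.1 hu
    exact ⟨(⟨w, hw⟩, ⟨x, hx⟩), rfl⟩

/-- The number of endomorphisms of `N` vanishing on `U`. -/
noncomputable def annihilatingEndCard (U : Submodule A N) : ℕ :=
  Nat.card {h : Module.End A N // U ≤ LinearMap.ker h}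

theorem annihilatingEndCard_top : annihilatingEndCard (⊤ : Submodule A N) = 1 := by
  rw [annihilatingEndCard, Nat.card_eq_one_iff_unique]
  refine ⟨⟨fun f g => Subtype.ext ?_⟩, ⟨0, by simp⟩⟩
  rw [LinearMap.ker_eq_top.1 (top_le_iff.1 f.2), LinearMap.ker_eq_top.1 (top_le_iff.1 g.2)]

/-- Subtracting from `f` its restriction to `X`, extended by zero along `K ⊇ W`, leaves a map
killing `W ⊔ X`; the restriction to `X` is arbitrary. -/
theorem annihilatingEndCard_eq_mul {W X K : Submodule A N} (h : IsCompl X K) (hW : W ≤ K) :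
    annihilatingEndCard W = annihilatingEndCard (W ⊔ X) * Nat.card (X →ₗ[A] N) := by
  rw [annihilatingEndCard, annihilatingEndCard, ← Nat.card_prod]
  refine (Nat.card_eq_of_bijective (fun p : {f : Module.End A N // W ⊔ X ≤ LinearMap.ker f} ×
    (X →ₗ[A] N) => (⟨p.1.1 + p.2 ∘ₗ X.projectionOnto K h, ?_⟩ :
      {f : Module.End A N // W ≤ LinearMap.ker f})) ⟨?_, ?_⟩).symm
  · intro w hw
    have h1 : p.1.1 w = 0 := p.1.2 (Submodule.mem_sup_left hw)
    have h2 : X.projectionOnto K h w = 0 := by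
      rw [← LinearMap.mem_ker, Submodule.ker_projectionOnto]
      exact hW hw
    simp [h1, h2]
  · rintro ⟨f, k⟩ ⟨f', k'⟩ e
    have e' : f.1 + k ∘ₗ X.projectionOnto K h = f'.1 + k' ∘ₗ X.projectionOnto K h :=
      congrArg Subtype.val e
    have hk : k = k' := by
      ext x
      have h1 := LinearMap.congr_fun e' (x : N)
      have h2 : f.1 x = 0 := f.2 (Submodule.mem_sup_right x.2)
      have h3 : f'.1 x = 0 := f'.2 (Submodule.mem_sup_right x.2)
      simpa [h2, h3] using h1
    subst hk
    rw [add_left_inj] at e'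
    rw [Subtype.ext e']
  · rintro ⟨f, hf⟩
    refine ⟨(⟨f - (f ∘ₗ X.subtype) ∘ₗ X.projectionOnto K h, ?_⟩, f ∘ₗ X.subtype), ?_⟩
    · refine sup_le (fun w hw => ?_) (fun x hx => ?_)
      · have h1 : f w = 0 := hf hw
        have h2 : X.projectionOnto K h w = 0 := by
          rw [← LinearMap.mem_ker, Submodule.ker_projectionOnto]
          exact hW hw
        simp [h1, h2]
      · have h2 : X.projectionOnto K h x = ⟨x, hx⟩ :=
          Submodule.projectionOnto_apply_left h ⟨x, hx⟩
        simp [h2]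
    · exact Subtype.ext (by simp)

/-- Complements of `K` are kernels of projections onto `K`, and such a projection is determined by
its restriction to `X`, which may be any map. -/
theorem card_complements {X K : Submodule A N} (h : IsCompl X K) :
    Nat.card {Y : Submodule A N // IsCompl K Y} = Nat.card (X →ₗ[A] K) := by
  rw [Nat.card_congr (Submodule.isComplEquivProj K)]
  refine Nat.card_eq_of_bijective (fun f => f.1 ∘ₗ X.subtype) ⟨?_, ?_⟩
  · rintro ⟨f, hf⟩ ⟨g, hg⟩ e
    refine Subtype.ext (LinearMap.ext fun n => ?_)
    have hn : n ∈ X ⊔ K := h.sup_eq_top ▸ Submodule.mem_top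
    obtain ⟨x, hx, k, hk, rfl⟩ := Submodule.mem_sup.1 hn
    have h1 : f x = g x := LinearMap.congr_fun e ⟨x, hx⟩
    have h2 : f k = g k := (hf ⟨k, hk⟩).trans (hg ⟨k, hk⟩).symm
    simp only [map_add, h1, h2]
  · intro g
    refine ⟨⟨K.projectionOnto X h.symm + g ∘ₗ X.projectionOnto K h, fun k => ?_⟩, ?_⟩
    · simp
    · ext x
      simp

theorem card_hom_eq_mul {X K : Submodule A N} (h : IsCompl X K) :
    Nat.card (X →ₗ[A] N) = Nat.card (X →ₗ[A] X) * Nat.card (X →ₗ[A] K) := by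
  rw [← Nat.card_prod]
  refine (Nat.card_eq_of_bijective (fun p : (X →ₗ[A] X) × (X →ₗ[A] K) =>
    X.subtype ∘ₗ p.1 + K.subtype ∘ₗ p.2) ⟨?_, ?_⟩).symm
  · rintro ⟨f, g⟩ ⟨f', g'⟩ e
    have h1 := congrArg (fun u => X.projectionOnto K h ∘ₗ u) e
    have h2 := congrArg (fun u => K.projectionOnto X h.symm ∘ₗ u) e
    refine Prod.ext (LinearMap.ext fun x => ?_) (LinearMap.ext fun x => ?_)
    · simpa using LinearMap.congr_fun h1 x
    · simpa using LinearMap.congr_fun h2 x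
  · intro u
    refine ⟨(X.projectionOnto K h ∘ₗ u, K.projectionOnto X h.symm ∘ₗ u), ?_⟩
    ext x
    simpa using Submodule.projection_add_projection_eq_self h (u x)

end Counting

/-! ### A weighted Möbius identity for semisimple modules -/

section SemisimpleIdentity

variable {A N : Type*} [AddCommGroup N]

/-- Evaluation at a generator is bijective: over a commutative ring, multiplication by a scalar is
linear and sends the generator to any prescribed element. -/
theorem card_end_of_isSimpleModule [CommRing A] [Module A N] [IsSimpleModule A N] :
    Nat.card (N →ₗ[A] N) = Nat.card N := by
  have := IsSimpleModule.nontrivial A N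
  obtain ⟨s, hs⟩ := exists_ne (0 : N)
  have hsurj := IsSimpleModule.toSpanSingleton_surjective A hs
  refine Nat.card_eq_of_bijective (fun f => f s) ⟨fun f g e => ?_, fun n => ?_⟩
  · ext n
    obtain ⟨a, rfl⟩ := hsurj n
    simp only [LinearMap.toSpanSingleton_apply, map_smul]
    exact congrArg _ e
  · obtain ⟨a, rfl⟩ := hsurj n
    exact ⟨a • LinearMap.id, rfl⟩

/-- Weisner's expansion of `μ(0, U)` along a hyperplane `K` not containing `U`. -/
theorem moebius_bot_eq_neg_sum_complements [Ring A] [Module A N] [Finite N] {K : Submodule A N}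
    (hK : IsCoatom K) {U : Submodule A N} (hU : ¬ U ≤ K) :
    moebius ⊥ U = - ∑ᶠ X : {X : {X : Submodule A N // IsCompl K X} // X.1 ≤ U},
      moebius X.1.1 U := by
  set B := {X : Submodule A N // IsCompl K X}
  -- Weisner's theorem is used in `[⊥, U]` with `c = U ⊓ K`. A nonzero `x ≤ U` meeting `K` trivially
  -- is a complement of `K`, because `K` is maximal; so the sum runs over `⊥` and the complements
  -- inside `U`.
  have hc : (⟨U ⊓ K, (inf_le_left : U ⊓ K ≤ U)⟩ : Set.Iic U) ≠ ⊤ := by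
    intro h
    exact hU (inf_eq_left.1 (congrArg Subtype.val h))
  have hW := sum_moebius_inf_eq hc ⊥ bot_le
  have hco : ∀ x : Set.Iic U, moebius x ⊤ = moebius x.1 U := fun x =>
    (moebius_map (OrderEmbedding.subtype (· ∈ Set.Iic U)) x ⊤
      (fun y _ hy => ⟨⟨y, hy⟩, rfl⟩)).symm
  have hUle : ∀ X : {X : B // X.1 ≤ U},
      (⟨X.1.1, X.2⟩ : Set.Iic U) ⊓ ⟨U ⊓ K, (inf_le_left : U ⊓ K ≤ U)⟩ = ⊥ := by
    intro X
    refine Subtype.ext ?_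
    change X.1.1 ⊓ (U ⊓ K) = ⊥
    rw [← le_bot_iff, ← X.1.2.inf_eq_bot]
    exact le_inf (inf_le_right.trans inf_le_right) inf_le_left
  let F : Option {X : B // X.1 ≤ U} →
    {x : Set.Iic U // x ⊓ ⟨U ⊓ K, (inf_le_left : U ⊓ K ≤ U)⟩ = ⊥} := fun o => match o with
      | none => ⟨⊥, bot_inf_eq _⟩
      | some X => ⟨⟨X.1.1, X.2⟩, hUle X⟩
  have hne : ∀ X : B, X.1 ≠ ⊥ := by
    intro X h
    have := X.2.sup_eq_top
    rw [h, sup_bot_eq] at this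
    exact hK.1 this
  have hF : Function.Bijective F := by
    constructor
    · rintro (_ | X) (_ | Y) e
      · rfl
      · exact absurd (congrArg (fun z => z.1.1) e).symm (hne Y.1)
      · exact absurd (congrArg (fun z => z.1.1) e) (hne X.1)
      · exact congrArg some (Subtype.ext (Subtype.ext (congrArg (fun z => z.1.1) e)))
    · rintro ⟨⟨x, hx⟩, h⟩
      by_cases hx0 : x = ⊥
      · subst hx0; exact ⟨none, rfl⟩
      · have h' : x ⊓ (U ⊓ K) = ⊥ := congrArg Subtype.val h
        rw [← inf_assoc, inf_eq_left.2 (show x ≤ U from hx)] at h'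
        have hxK : ¬ x ≤ K := fun hle => hx0 (by rwa [inf_eq_left.2 hle] at h')
        refine ⟨some ⟨⟨x, ?_⟩, hx⟩, rfl⟩
        refine ⟨disjoint_iff.2 (by rwa [inf_comm]), codisjoint_iff.2 (hK.2 _ ?_)⟩
        exact left_lt_sup.2 hxK
  rw [← finsum_comp F hF, finsum_option_of_finite] at hW
  simp only [hco, F] at hW
  change moebius ⊥ U + _ = 0 at hW
  exact eq_neg_of_add_eq_zero_left hW

/-- By modularity, `W ↦ W ⊔ X` is an isomorphism from `[⊥, K]` onto `[X, ⊤]`. -/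
theorem moebius_bot_eq_moebius_sup [Ring A] [Module A N] {K X : Submodule A N}
    (hX : IsCompl K X) {W : Submodule A N} (hW : W ≤ K) : moebius ⊥ W = moebius X (W ⊔ X) := by
  let e := infIccOrderIsoIccSup K X
  have hbot : K ⊓ X ≤ K := inf_le_left
  have hW' : W ∈ Set.Icc (K ⊓ X) K := ⟨by rw [hX.inf_eq_bot]; exact bot_le, hW⟩
  have a1 := moebius_orderIso e ⟨K ⊓ X, le_rfl, hbot⟩ ⟨W, hW'⟩
  have a2 := moebius_map (OrderEmbedding.subtype (· ∈ Set.Icc (K ⊓ X) K))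
    ⟨K ⊓ X, le_rfl, hbot⟩ ⟨W, hW'⟩
    (fun y h1 h2 => ⟨⟨y, h1, le_trans h2 hW⟩, rfl⟩)
  have a3 := moebius_map (OrderEmbedding.subtype (· ∈ Set.Icc X (K ⊔ X)))
    (e ⟨K ⊓ X, le_rfl, hbot⟩) (e ⟨W, hW'⟩)
    (fun y h1 h2 => ⟨⟨y, le_sup_right.trans h1, le_trans h2 (e ⟨W, hW'⟩).2.2⟩, rfl⟩)
  have a4 : moebius (K ⊓ X) W = moebius (K ⊓ X ⊔ X) (W ⊔ X) := a2.trans (a1.symm.trans a3.symm)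
  rwa [hX.inf_eq_bot, bot_sup_eq] at a4

/-- The identity `∑ |U| μ(0, U) |Hom(N / U, N)| = 0` for a nonzero finite semisimple module. -/
theorem sum_card_mul_moebius_mul_annihilatingEndCard [CommRing A] [Module A N] [Finite N]
    [IsSemisimpleModule A N] [Nontrivial N] :
    ∑ᶠ U : Submodule A N, (Nat.card U : ℤ) * moebius ⊥ U * annihilatingEndCard U = 0 := by
  obtain ⟨K, hK, -⟩ := (eq_top_or_exists_le_coatom (⊥ : Submodule A N)).resolve_left bot_ne_top
  set B := {X : Submodule A N // IsCompl K X}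
  set g : Submodule A N → ℤ := fun U => (Nat.card U : ℤ) * moebius ⊥ U * annihilatingEndCard U
    with hg
  set C : ℤ := (Nat.card B : ℤ) with hC
  have hC0 : C ≠ 0 := by
    obtain ⟨X, hX⟩ := exists_isCompl K
    have : Nonempty B := ⟨⟨X, hX⟩⟩
    rw [hC]
    exact_mod_cast (Nat.card_pos (α := B)).ne'
  -- Reindex by `U = W ⊔ X` with `W ≤ K`. The size of `U` gains a factor `|X|`, while
  -- `annihilatingEndCard` loses a factor `|Hom(X, N)| = |End X| |Hom(X, K)| = |X| C`. The factors
  -- `|X|` cancel and the outcome no longer depends on `X`.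
  have h2 : ∀ X : B, C * ∑ᶠ U : {U : Submodule A N // X.1 ≤ U},
      (Nat.card U.1 : ℤ) * moebius X.1 U.1 * annihilatingEndCard U.1 =
      ∑ᶠ W : {W // W ≤ K}, g W.1 := by
    rintro ⟨X, hX⟩
    have hs : IsSimpleModule A X :=
      have := isSimpleModule_iff_isCoatom.2 hK
      IsSimpleModule.congr (Submodule.quotientEquivOfIsCompl K X hX).symm
    have hcard : (Nat.card (X →ₗ[A] N) : ℤ) = Nat.card X * C := by
      rw [card_hom_eq_mul hX.symm, ← card_complements hX.symm, card_end_of_isSimpleModule]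
      push_cast
      rfl
    rw [mul_finsum_of_finite]
    symm
    let e := infIccOrderIsoIccSup K X
    have hsup : ∀ W : Set.Icc (K ⊓ X) K, (e W : Submodule A N) = W.1 ⊔ X := fun W => rfl
    refine finsum_eq_of_bijective
      (fun W => ⟨W.1 ⊔ X, le_sup_right⟩) ⟨?_, ?_⟩ ?_
    · intro W W' h
      have := e.injective (a₁ := ⟨W.1, by rw [hX.inf_eq_bot]; exact bot_le, W.2⟩)
        (a₂ := ⟨W'.1, by rw [hX.inf_eq_bot]; exact bot_le, W'.2⟩)
        (Subtype.ext (show W.1 ⊔ X = W'.1 ⊔ X from (Subtype.ext_iff.1 h :)))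
      exact Subtype.ext (Subtype.ext_iff.1 this :)
    · rintro ⟨U, hU⟩
      obtain ⟨W, hW⟩ := e.surjective ⟨U, hU, by rw [hX.sup_eq_top]; exact le_top⟩
      exact ⟨⟨W.1, W.2.2⟩, Subtype.ext (show W.1 ⊔ X = U from (Subtype.ext_iff.1 hW :))⟩
    · rintro ⟨W, hW⟩
      have hm := moebius_bot_eq_moebius_sup hX hW
      have hd : Disjoint W X := hX.disjoint.mono_left hW
      simp only [hg]
      rw [annihilatingEndCard_eq_mul hX.symm hW, card_sup_of_disjoint hd, hm]
      push_cast
      rw [hcard]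
      ring
  have h3 : ∑ᶠ U : {U : Submodule A N // ¬ U ≤ K}, g U.1 =
      - ∑ᶠ X : B, ∑ᶠ U : {U : Submodule A N // X.1 ≤ U},
      (Nat.card U.1 : ℤ) * moebius X.1 U.1 * annihilatingEndCard U.1 := by
    rw [← finsum_subtype_comm (fun (U : Submodule A N) (X : B) => X.1 ≤ U)
      (fun U X => (Nat.card U : ℤ) * moebius X.1 U * annihilatingEndCard U),
      finsum_subtype_add_subtype_not (fun U : Submodule A N => U ≤ K)]
    have hz : ∀ U : {U : Submodule A N // U ≤ K}, ∑ᶠ X : {X : B // X.1 ≤ U.1},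
        (Nat.card U.1 : ℤ) * moebius X.1.1 U.1 * annihilatingEndCard U.1 = 0 := by
      intro U
      have : IsEmpty {X : B // X.1 ≤ U.1} := by
        refine ⟨fun X => hK.1 ?_⟩
        rw [← X.1.2.sup_eq_top, left_eq_sup]
        exact X.2.trans U.2
      exact finsum_of_isEmpty _
    simp only [hz, finsum_zero, zero_add]
    rw [← finsum_neg_distrib]
    refine finsum_congr fun U => ?_
    change (Nat.card U.1 : ℤ) * moebius ⊥ U.1 * annihilatingEndCard U.1 = _
    rw [moebius_bot_eq_neg_sum_complements hK U.2, ← finsum_neg_distrib, mul_finsum_of_finite,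
      finsum_mul_of_finite, ← finsum_neg_distrib]
    exact finsum_congr fun X => by ring
  -- The terms with `U ≤ K` contribute `C` copies of their sum. The others contribute minus one copy
  -- for each of the `C` complements.
  have h4 : C * ∑ᶠ U, g U = 0 := by
    rw [finsum_subtype_add_subtype_not (fun U : Submodule A N => U ≤ K), h3, mul_add, mul_neg,
      add_neg_eq_zero, eq_comm, mul_finsum_of_finite, finsum_congr h2, finsum_const_of_finite,
      nsmul_eq_mul]
  exact (mul_eq_zero.1 h4).resolve_left hC0

end SemisimpleIdentity

/-! ### Summing Möbius invariants over endomorphisms of a semisimple module -/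

section EndomorphismSum

variable {A N : Type*} [AddCommGroup N]

/-- The sum over all endomorphisms `φ` of the Möbius invariant of the lattice of `φ`-stable
submodules. -/
noncomputable def endMoebiusSum (A N : Type*) [Ring A] [AddCommGroup N] [Module A N] : ℤ :=
  ∑ᶠ φ : Module.End A N, stableMoebius {φ}

/-- Sum `μ(0, U)` over pairs of an endomorphism `φ` and a `φ`-stable `U`. For fixed `φ` the total is
zero. Grouping instead by `U` and `ψ = φ|_U`, each `ψ` is counted once per extension to `N`. -/
theorem sum_annihilatingEndCard_mul_endMoebiusSum [Ring A] [Module A N] [Finite N]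
    [IsSemisimpleModule A N] [Nontrivial N] :
    ∑ᶠ U : Submodule A N, (annihilatingEndCard U : ℤ) * endMoebiusSum A U = 0 := by
  have h0 : ∀ φ : Module.End A N,
      ∑ᶠ U : stableSubmodules {φ}, moebius (⊥ : stableSubmodules {φ}) U = 0 := fun φ =>
    sum_moebius_bot fun h => bot_ne_top (α := Submodule A N) (congrArg Subtype.val h)
  have h1 : ∑ᶠ p : Σ φ : Module.End A N, stableSubmodules {φ},
      moebius (⊥ : stableSubmodules {p.1}) p.2 = 0 := by
    rw [finsum_sigma_of_finite]
    simp only [h0, finsum_zero]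
  -- Semisimplicity provides one extension `φ₀` of `ψ`; the others differ from it by maps vanishing
  -- on `U`.
  have hex : ∀ (U : Submodule A N) (ψ : Module.End A U),
      Nat.card {φ : Module.End A N // ∀ u : U, φ u = ψ u} = annihilatingEndCard U := by
    intro U ψ
    obtain ⟨φ₀, h₀⟩ := IsSemisimpleModule.extension_property U.subtype U.subtype_injective
      (U.subtype ∘ₗ ψ)
    have h₀' : ∀ u : U, φ₀ u = ψ u := fun u => LinearMap.congr_fun h₀ u
    refine Nat.card_congr
      { toFun := fun φ => ⟨φ.1 - φ₀, fun u hu => ?_⟩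
        invFun := fun h => ⟨h.1 + φ₀, fun u => ?_⟩
        left_inv := fun φ => Subtype.ext (sub_add_cancel _ _)
        right_inv := fun h => Subtype.ext (add_sub_cancel_right _ _) }
    · have := φ.2 ⟨u, hu⟩
      simp only at this
      simp [this, h₀' ⟨u, hu⟩]
    · have : h.1 u = 0 := h.2 u.2
      simp [this, h₀' u]
  rw [← h1]
  have h2 : ∑ᶠ q : Σ U : Submodule A N, Σ ψ : Module.End A U,
      {φ : Module.End A N // ∀ u : U, φ u = ψ u}, stableMoebius {q.2.1} =
      ∑ᶠ U : Submodule A N, (annihilatingEndCard U : ℤ) * endMoebiusSum A U := by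
    rw [finsum_sigma_of_finite]
    refine finsum_congr fun U => ?_
    rw [finsum_sigma_of_finite, endMoebiusSum, mul_finsum_of_finite]
    refine finsum_congr fun ψ => ?_
    rw [finsum_const_of_finite (stableMoebius {ψ}), hex, nsmul_eq_mul]
  rw [← h2]
  have hst : ∀ (U : Submodule A N) (ψ : Module.End A U)
      (φ : {φ : Module.End A N // ∀ u : U, φ u = ψ u}), U ∈ stableSubmodules {φ.1} := by
    rintro U ψ φ f rfl u hu
    have := φ.2 ⟨u, hu⟩
    simp only at this
    rw [Submodule.mem_comap, this]
    exact (ψ ⟨u, hu⟩).2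
  refine finsum_eq_of_bijective (fun q => ⟨q.2.2.1, ⟨q.1, hst q.1 q.2.1 q.2.2⟩⟩) ⟨?_, ?_⟩ ?_
  · rintro ⟨U, ψ, φ, h⟩ ⟨U', ψ', φ', h'⟩ e
    have e1 : φ = φ' := congrArg Sigma.fst e
    subst e1
    have e2 : U = U' := by simpa using e
    subst e2
    have e3 : ψ = ψ' := by
      ext u
      exact (h u).symm.trans (h' u)
    subst e3
    rfl
  · rintro ⟨φ, U, hU⟩
    exact ⟨⟨U, φ.restrict (hU φ rfl), φ, fun u => rfl⟩, rfl⟩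
  · rintro ⟨U, ψ, φ, h⟩
    refine stableMoebius_eq_moebius_of_restrict ⟨U, hst U ψ ⟨φ, h⟩⟩ ?_ ?_
    · rintro f rfl
      exact ⟨ψ, rfl, h⟩
    · intro f hf
      rw [Set.mem_singleton_iff] at hf
      exact ⟨φ, rfl, by rw [hf]; exact h⟩

theorem endMoebiusSum_congr [Ring A] [Module A N] {N' : Type*} [AddCommGroup N'] [Module A N']
    (e : N ≃ₗ[A] N') : endMoebiusSum A N = endMoebiusSum A N' := by
  refine finsum_eq_of_bijective e.conjRingEquiv e.conjRingEquiv.bijective fun φ =>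
    stableMoebius_congr e ?_ ?_
  · rintro f rfl
    exact ⟨_, rfl, fun m => by simp⟩
  · rintro f rfl
    exact ⟨φ, rfl, fun m => by simp⟩

/-- Subtract the two vanishing sums over submodules of `N`. By induction on the cardinality all
proper submodules cancel, and `U = ⊤` has weight `1`. -/
theorem endMoebiusSum_of_isSemisimpleModule [CommRing A] (n : ℕ) :
    ∀ (N : Type*) [AddCommGroup N] [Module A N] [Finite N] [IsSemisimpleModule A N],
      Nat.card N = n → endMoebiusSum A N = Nat.card N * moebius (⊥ : Submodule A N) ⊤ := by
  induction n using Nat.strong_induction_on with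
  | _ n ih =>
  intro N _ _ _ _ hn
  rcases subsingleton_or_nontrivial N with hN | hN
  · rw [endMoebiusSum, Subsingleton.elim (⊥ : Submodule A N) ⊤, moebius_self]
    simp only [stableMoebius_of_subsingleton]
    rw [finsum_const_of_finite, Nat.card_of_subsingleton (0 : N),
      Nat.card_of_subsingleton (0 : Module.End A N)]
    simp
  · have h1 := sum_annihilatingEndCard_mul_endMoebiusSum (A := A) (N := N)
    have h2 := sum_card_mul_moebius_mul_annihilatingEndCard (A := A) (N := N)
    have h3 : ∑ᶠ U : Submodule A N, ((annihilatingEndCard U : ℤ) * endMoebiusSum A U -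
        (Nat.card U : ℤ) * moebius ⊥ U * annihilatingEndCard U) = 0 := by
      rw [finsum_sub_distrib (Set.toFinite _) (Set.toFinite _), h1, h2, sub_zero]
    rw [finsum_eq_single _ ⊤] at h3
    · rw [annihilatingEndCard_top, Nat.card_congr Submodule.topEquiv.toEquiv,
        endMoebiusSum_congr Submodule.topEquiv] at h3
      linear_combination h3
    · intro U hU
      rw [ih (Nat.card U) ?_ U rfl, moebius_bot_top_submodule]
      · ring
      · rw [← hn]
        exact Finite.card_subtype_lt (p := (· ∈ U)) (SetLike.exists_not_mem_of_ne_top U hU).choose_spec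

end EndomorphismSum

/-! ### Endomorphisms commuting with a commutative family -/

section CommutingEndomorphisms

/-- A finite reduced commutative ring is semisimple. Otherwise a nonzero nilpotent `a` acts
nontrivially by faithfulness, commutes with every `A`-endomorphism and preserves every submodule, so
both sides vanish. -/
theorem endMoebiusSum_eq {A N : Type*} [CommRing A] [AddCommGroup N] [Module A N] [Finite A]
    [Finite N] [FaithfulSMul A N] :
    endMoebiusSum A N = Nat.card N * moebius (⊥ : Submodule A N) ⊤ := by
  by_cases hA : IsReduced A
  · have := IsArtinianRing.isSemisimpleRing_of_isReduced A
    exact endMoebiusSum_of_isSemisimpleModule _ N rfl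
  · obtain ⟨a, ha, ha0⟩ : ∃ a : A, IsNilpotent a ∧ a ≠ 0 := by
      by_contra! h
      exact hA ⟨h⟩
    set α : Module.End A N := algebraMap A (Module.End A N) a with hα
    have hα0 : α ≠ 0 := by
      intro h
      refine ha0 (FaithfulSMul.eq_of_smul_eq_smul (α := N) fun n => ?_)
      rw [zero_smul]
      exact LinearMap.congr_fun h n
    have hαn : IsNilpotent α := ha.map _
    have key : ∀ T : Set (Module.End A N), stableMoebius T = 0 := fun T =>
      stableMoebius_eq_zero_of_isNilpotent hαn hα0
        (fun f _ => (Algebra.commutes a f).symm) (fun U _ u hu => U.smul_mem a hu)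
    rw [endMoebiusSum, ← stableMoebius_empty, key, mul_zero]
    simp only [key, finsum_zero]

theorem endMoebiusSum_eq_of_commute {A N : Type*} [Ring A] [AddCommGroup N] [Module A N]
    [Finite A] [Finite N] [FaithfulSMul A N] (hA : ∀ a b : A, a * b = b * a) :
    endMoebiusSum A N = Nat.card N * moebius (⊥ : Submodule A N) ⊤ :=
  letI : CommRing A := { ‹Ring A› with mul_comm := hA }
  endMoebiusSum_eq

variable {K V : Type*} [Field K] [AddCommGroup V] [Module K V]

theorem smul_mem_of_mem_stableSubmodules {S : Set (Module.End K V)} {U : Submodule K V}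
    (hU : U ∈ stableSubmodules S) (a : Algebra.adjoin K S) {u : V} (hu : u ∈ U) : a • u ∈ U := by
  let B : Subalgebra K (Module.End K V) :=
    { carrier := {f | ∀ u ∈ U, f u ∈ U}
      mul_mem' := fun hf hg u hu => hf _ (hg u hu)
      add_mem' := fun hf hg u hu => U.add_mem (hf u hu) (hg u hu)
      algebraMap_mem' := fun r u hu => U.smul_mem r hu }
  have : Algebra.adjoin K S ≤ B := Algebra.adjoin_le fun f hf => hU f hf
  exact this a.2 u hu

theorem stableMoebius_adjoin {S T : Set (Module.End K V)}
    {T' : Set (Module.End (Algebra.adjoin K S) V)}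
    (h : ∀ U : Submodule K V, U ∈ stableSubmodules T ↔
      U ∈ stableSubmodules S ∧ ∀ f ∈ T', ∀ u ∈ U, f u ∈ U) :
    stableMoebius T' = stableMoebius T := by
  have hS : ∀ U : Submodule (Algebra.adjoin K S) V,
      U.restrictScalars K ∈ stableSubmodules S := fun U f hf u hu =>
    U.smul_mem ⟨f, Algebra.subset_adjoin hf⟩ hu
  let F : stableSubmodules T' ≃o stableSubmodules T :=
    { toFun := fun U => ⟨U.1.restrictScalars K, (h _).2 ⟨hS _, U.2⟩⟩
      invFun := fun U => ⟨{ U.1 with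
        smul_mem' := fun a _ hu => smul_mem_of_mem_stableSubmodules ((h _).1 U.2).1 a hu },
        ((h _).1 U.2).2⟩
      left_inv := fun _ => rfl
      right_inv := fun _ => rfl
      map_rel_iff' := Iff.rfl }
  rw [stableMoebius, stableMoebius, ← moebius_orderIso F, map_bot, map_top]

/-- Summing the Möbius invariant over the endomorphisms commuting with a commutative family
multiplies it by the number of vectors. -/
theorem sum_stableMoebius_insert [Finite V] {S : Set (Module.End K V)}
    (hS : ∀ f ∈ S, ∀ g ∈ S, f * g = g * f) :
    ∑ᶠ φ : {φ : Module.End K V // ∀ f ∈ S, Commute f φ}, stableMoebius (insert φ.1 S) =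
      Nat.card V * stableMoebius S := by
  -- Let `A` be the algebra generated by `S`: its submodules are the `S`-stable subspaces, and its
  -- endomorphisms of `V` are the `φ` commuting with `S`. It is commutative and acts faithfully.
  have hcomm : ∀ a b : Algebra.adjoin K S, a * b = b * a :=
    (Algebra.isMulCommutative_adjoin K hS).is_comm.comm
  have hfaith : FaithfulSMul (Algebra.adjoin K S) V :=
    ⟨fun h => Subtype.ext (LinearMap.ext h)⟩
  have hfin : Finite (Algebra.adjoin K S) := inferInstance
  have h1 : moebius (⊥ : Submodule (Algebra.adjoin K S) V) ⊤ = stableMoebius S := by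
    rw [← stableMoebius_empty]
    exact stableMoebius_adjoin fun U => by simp
  rw [← h1, ← endMoebiusSum_eq_of_commute hcomm]
  have hlin : ∀ φ : {φ : Module.End K V // ∀ f ∈ S, Commute f φ}, ∀ (a : Algebra.adjoin K S) (v : V),
      φ.1 (a • v) = a • φ.1 v := by
    rintro ⟨φ, hφ⟩ ⟨a, ha⟩ v
    have h2 : Algebra.adjoin K S ≤ Subalgebra.centralizer K {φ} :=
      Algebra.adjoin_le fun f hf => by
        rw [SetLike.mem_coe, Subalgebra.mem_centralizer_iff]
        rintro g rfl
        exact (hφ f hf).symm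
    have h3 := (Subalgebra.mem_centralizer_iff K).1 (h2 ha) φ rfl
    exact LinearMap.congr_fun h3 v
  refine finsum_eq_of_bijective
    (fun φ => { φ.1 with map_smul' := hlin φ }) ⟨?_, ?_⟩ ?_
  · intro φ ψ e
    exact Subtype.ext (LinearMap.ext fun v => LinearMap.congr_fun e v)
  · intro ψ
    refine ⟨⟨ψ.restrictScalars K, fun f hf => LinearMap.ext fun v => ?_⟩, rfl⟩
    exact (ψ.map_smul ⟨f, Algebra.subset_adjoin hf⟩ v).symm
  · intro φ
    refine (stableMoebius_adjoin fun U => ?_).symm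
    simp only [mem_stableSubmodules, Set.mem_insert_iff, Set.mem_singleton_iff, forall_eq_or_imp,
      forall_eq]
    exact and_comm

end CommutingEndomorphisms

/-! ### Fitting decomposition of commuting tuples -/

section FittingDecomposition

theorem stableMoebius_of_mem_iff {R M : Type*} [Ring R] [AddCommGroup M] [Module R M]
    {T T' : Set (Module.End R M)} (h : ∀ U, U ∈ stableSubmodules T ↔ U ∈ stableSubmodules T') :
    stableMoebius T = stableMoebius T' := by
  let F : stableSubmodules T ≃o stableSubmodules T' :=
    { toEquiv := Equiv.subtypeEquivRight h
      map_rel_iff' := Iff.rfl }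
  rw [stableMoebius, stableMoebius, ← moebius_orderIso F, map_bot, map_top]

/-- The hypothesis `h` makes each stable submodule the product of its two components, so the stable
lattice is a product and `moebius_prod` applies. -/
theorem stableMoebius_prodMap {R M₁ M₂ : Type*} [Ring R] [AddCommGroup M₁] [AddCommGroup M₂]
    [Module R M₁] [Module R M₂] [Finite M₁] [Finite M₂] {ι : Type*} (f : ι → Module.End R M₁)
    (g : ι → Module.End R M₂)
    (h : ∀ U ∈ stableSubmodules (Set.range fun i => (f i).prodMap (g i)), ∀ u ∈ U, (u.1, 0) ∈ U) :
    stableMoebius (Set.range fun i => (f i).prodMap (g i)) =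
      stableMoebius (Set.range f) * stableMoebius (Set.range g) := by
  let F : stableSubmodules (Set.range f) × stableSubmodules (Set.range g) ↪o
      stableSubmodules (Set.range fun i => (f i).prodMap (g i)) :=
    OrderEmbedding.ofMapLEIff (fun p => ⟨p.1.1.prod p.2.1, by
      rintro _ ⟨i, rfl⟩ ⟨u, v⟩ ⟨hu, hv⟩
      exact ⟨p.1.2 _ ⟨i, rfl⟩ hu, p.2.2 _ ⟨i, rfl⟩ hv⟩⟩) (by
      rintro ⟨U, V⟩ ⟨U', V'⟩
      constructor
      · intro hle
        exact ⟨fun u hu => (hle (show (u, (0 : M₂)) ∈ U.1.prod V.1 from ⟨hu, V.1.zero_mem⟩)).1,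
          fun v hv => (hle (show ((0 : M₁), v) ∈ U.1.prod V.1 from ⟨U.1.zero_mem, hv⟩)).2⟩
      · rintro ⟨h1, h2⟩ ⟨u, v⟩ ⟨hu, hv⟩
        exact ⟨h1 hu, h2 hv⟩)
  have hb : F ⊥ = ⊥ := Subtype.ext (by
    change Submodule.prod ⊥ ⊥ = ⊥
    exact Submodule.prod_bot)
  have ht : F ⊤ = ⊤ := Subtype.ext (by
    change Submodule.prod ⊤ ⊤ = ⊤
    exact Submodule.prod_top)
  rw [stableMoebius, ← hb, ← ht, moebius_map F]
  · exact moebius_prod _ _ bot_le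
  · intro U _ _
    refine ⟨(⟨U.1.comap (LinearMap.inl R M₁ M₂), ?_⟩,
      ⟨U.1.comap (LinearMap.inr R M₁ M₂), ?_⟩), Subtype.ext ?_⟩
    · rintro _ ⟨i, rfl⟩ u hu
      have := U.2 _ ⟨i, rfl⟩ hu
      simpa using this
    · rintro _ ⟨i, rfl⟩ u hu
      have := U.2 _ ⟨i, rfl⟩ hu
      simpa using this
    · change Submodule.prod _ _ = U.1
      ext ⟨u, v⟩
      simp only [Submodule.mem_prod, Submodule.mem_comap, LinearMap.inl_apply,
        LinearMap.inr_apply]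
      constructor
      · rintro ⟨h1, h2⟩
        simpa using U.1.add_mem h1 h2
      · intro huv
        have h1 := h U.1 U.2 _ huv
        exact ⟨h1, by simpa using U.1.sub_mem huv h1⟩

variable {K V : Type*} [Field K] [AddCommGroup V] [Module K V]

/-- The block sum of endomorphisms of two complementary subspaces. -/
noncomputable def blockSum {V₁ V₂ : Submodule K V} (h : IsCompl V₁ V₂) :
    Module.End K V₁ × Module.End K V₂ →+* Module.End K V :=
  ((V₁.prodEquivOfIsCompl V₂ h).conjRingEquiv : _ →+* Module.End K V).comp
    (LinearMap.prodMapRingHom K V₁ V₂)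

theorem blockSum_apply {V₁ V₂ : Submodule K V} (h : IsCompl V₁ V₂)
    (f : Module.End K V₁ × Module.End K V₂) (v : V₁ × V₂) :
    blockSum h f (V₁.prodEquivOfIsCompl V₂ h v) =
      V₁.prodEquivOfIsCompl V₂ h (f.1.prodMap f.2 v) := by
  simp [blockSum]

theorem blockSum_apply_left {V₁ V₂ : Submodule K V} (h : IsCompl V₁ V₂)
    (f : Module.End K V₁ × Module.End K V₂) (v : V₁) : blockSum h f v = f.1 v := by
  simpa using blockSum_apply h f (v, 0)

theorem blockSum_apply_right {V₁ V₂ : Submodule K V} (h : IsCompl V₁ V₂)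
    (f : Module.End K V₁ × Module.End K V₂) (v : V₂) : blockSum h f v = f.2 v := by
  simpa using blockSum_apply h f (0, v)

theorem blockSum_injective {V₁ V₂ : Submodule K V} (h : IsCompl V₁ V₂) :
    Function.Injective (blockSum h) := by
  intro f g e
  refine Prod.ext (LinearMap.ext fun v => Subtype.ext ?_) (LinearMap.ext fun v => Subtype.ext ?_)
  · rw [← blockSum_apply_left h, ← blockSum_apply_left h, e]
  · rw [← blockSum_apply_right h, ← blockSum_apply_right h, e]

theorem blockSum_restrict {V₁ V₂ : Submodule K V} (h : IsCompl V₁ V₂) (f : Module.End K V)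
    (h₁ : ∀ v ∈ V₁, f v ∈ V₁) (h₂ : ∀ v ∈ V₂, f v ∈ V₂) :
    blockSum h (f.restrict h₁, f.restrict h₂) = f := by
  refine LinearMap.ext fun v => ?_
  obtain ⟨w, rfl⟩ := (V₁.prodEquivOfIsCompl V₂ h).surjective v
  rw [blockSum_apply]
  simp

theorem commute_blockSum_iff {V₁ V₂ : Submodule K V} (h : IsCompl V₁ V₂)
    (f g : Module.End K V₁ × Module.End K V₂) :
    Commute (blockSum h f) (blockSum h g) ↔ Commute f.1 g.1 ∧ Commute f.2 g.2 := by
  rw [Commute, SemiconjBy, ← map_mul, ← map_mul, (blockSum_injective h).eq_iff, Prod.ext_iff]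
  rfl

theorem isUnit_of_injective [Finite V] {f : Module.End K V} (h : Function.Injective f) :
    IsUnit f :=
  (Module.End.isUnit_iff f).2 (Finite.injective_iff_bijective.1 h)

theorem injective_of_isUnit {f : Module.End K V} (h : IsUnit f) : Function.Injective f :=
  ((Module.End.isUnit_iff f).1 h).1

theorem isUnit_blockSum_iff [Finite V] {V₁ V₂ : Submodule K V} (h : IsCompl V₁ V₂)
    (f : Module.End K V₁ × Module.End K V₂) :
    IsUnit (blockSum h f) ↔ IsUnit f.1 ∧ IsUnit f.2 := by
  constructor
  · intro hu
    have hinj := injective_of_isUnit hu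
    refine ⟨isUnit_of_injective fun v w e => ?_, isUnit_of_injective fun v w e => ?_⟩
    · apply Subtype.ext
      apply hinj
      rw [blockSum_apply_left, blockSum_apply_left, e]
    · apply Subtype.ext
      apply hinj
      rw [blockSum_apply_right, blockSum_apply_right, e]
  · intro hu
    exact (Prod.isUnit_iff.2 hu).map (blockSum h)

/-- Some power of the `i`-th block sum is the projection onto `V₁` along `V₂`, so every stable
subspace splits. -/
theorem stableMoebius_blockSum [Finite V] {V₁ V₂ : Submodule K V} (h : IsCompl V₁ V₂) {ι : Type*}
    (f : ι → Module.End K V₁ × Module.End K V₂) (i : ι) (h₁ : IsUnit (f i).1)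
    (h₂ : IsNilpotent (f i).2) :
    stableMoebius (Set.range fun j => blockSum h (f j)) =
      stableMoebius (Set.range fun j => (f j).1) * stableMoebius (Set.range fun j => (f j).2) := by
  rw [← stableMoebius_prodMap]
  · refine (stableMoebius_congr (V₁.prodEquivOfIsCompl V₂ h) ?_ ?_).symm
    · rintro _ ⟨j, rfl⟩
      exact ⟨_, ⟨j, rfl⟩, fun m => (blockSum_apply h (f j) m).symm⟩
    · rintro _ ⟨j, rfl⟩
      exact ⟨_, ⟨j, rfl⟩, fun m => (blockSum_apply h (f j) m).symm⟩
  · intro U hU u hu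
    obtain ⟨φ, hφ⟩ := h₁
    obtain ⟨n, hn⟩ := h₂
    have hpow : ∀ k : ℕ, ∀ u ∈ U, (((f i).1 ^ k) u.1, ((f i).2 ^ k) u.2) ∈ U := by
      intro k
      induction k with
      | zero => intro u hu; simpa using hu
      | succ k ih =>
        intro u hu
        have := ih _ (hU _ ⟨i, rfl⟩ hu)
        simpa [pow_succ] using this
    -- The exponent `orderOf φ * n` makes the invertible block `1` and the nilpotent block `0`; the
    -- latter needs the order to be positive.
    have hord : 0 < orderOf φ := orderOf_pos φ
    have := hpow (orderOf φ * n) u hu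
    rw [pow_mul, ← hφ, ← Units.val_pow_eq_pow_val, pow_orderOf_eq_one, mul_comm, pow_mul, hn,
      zero_pow hord.ne'] at this
    simpa using this

/-- Tuples of pairwise commuting automorphisms of `V`. -/
abbrev CommutingTuple (r : ℕ) (K V : Type*) [Field K] [AddCommGroup V] [Module K V] : Type _ :=
  {t : Fin r → Module.End K V // (∀ i, IsUnit (t i)) ∧ ∀ i j, Commute (t i) (t j)}

/-- Tuples of pairwise commuting endomorphisms, all invertible except possibly the first. -/
abbrev CommutingTupleWithEnd (r : ℕ) (K V : Type*) [Field K] [AddCommGroup V] [Module K V] :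
    Type _ :=
  {s : Fin (r + 1) → Module.End K V // (∀ i : Fin r, IsUnit (s i.succ)) ∧
    ∀ i j, Commute (s i) (s j)}

/-- The sum of the Möbius invariants over all commuting `r`-tuples of automorphisms. -/
noncomputable def tupleMoebiusSum (r : ℕ) (K V : Type*) [Field K] [AddCommGroup V] [Module K V] :
    ℤ :=
  ∑ᶠ t : CommutingTuple r K V, stableMoebius (Set.range t.1)

/-- Fix the automorphisms and sum over the first entry with `sum_stableMoebius_insert`. -/
theorem sum_commutingTupleWithEnd [Finite V] (r : ℕ) :
    ∑ᶠ s : CommutingTupleWithEnd r K V, stableMoebius (Set.range s.1) =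
      Nat.card V * tupleMoebiusSum r K V := by
  rw [tupleMoebiusSum, mul_finsum_of_finite]
  have h1 : ∀ t : CommutingTuple r K V, Nat.card V * stableMoebius (Set.range t.1) =
      ∑ᶠ φ : {φ : Module.End K V // ∀ f ∈ Set.range t.1, Commute f φ},
        stableMoebius (insert φ.1 (Set.range t.1)) := by
    intro t
    rw [sum_stableMoebius_insert]
    rintro _ ⟨i, rfl⟩ _ ⟨j, rfl⟩
    exact t.2.2 i j
  simp only [h1]
  rw [← finsum_sigma_of_finite (fun p : Σ t : CommutingTuple r K V,
    {φ : Module.End K V // ∀ f ∈ Set.range t.1, Commute f φ} =>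
    stableMoebius (insert p.2.1 (Set.range p.1.1)))]
  symm
  refine finsum_eq_of_bijective (fun p => ⟨Fin.cons p.2.1 p.1.1, ?_, ?_⟩) ⟨?_, ?_⟩ ?_
  · intro i
    simpa using p.1.2.1 i
  · intro i j
    refine Fin.cases ?_ (fun i => ?_) i <;> refine Fin.cases ?_ (fun j => ?_) j
    · exact Commute.refl _
    · simpa using (p.2.2 _ ⟨j, rfl⟩).symm
    · simpa using p.2.2 _ ⟨i, rfl⟩
    · simpa using p.1.2.2 i j
  · rintro ⟨⟨t, ht⟩, ⟨φ, hφ⟩⟩ ⟨⟨t', ht'⟩, ⟨φ', hφ'⟩⟩ e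
    have e' := Subtype.ext_iff.1 e
    simp only [Fin.cons_inj] at e'
    obtain ⟨rfl, rfl⟩ := e'
    rfl
  · rintro ⟨s, hs⟩
    refine ⟨⟨⟨Fin.tail s, hs.1, fun i j => hs.2 _ _⟩, ⟨s 0, ?_⟩⟩, Subtype.ext (Fin.cons_self_tail s)⟩
    rintro _ ⟨i, rfl⟩
    exact hs.2 _ _
  · rintro ⟨t, φ⟩
    simp only [Fin.range_cons]

/-- A nonzero nilpotent first entry commutes with the tuple, so its invariant vanishes. A zero first
entry imposes no stability condition. -/
theorem sum_commutingTupleWithEnd_nilpotent [Finite V] (r : ℕ) :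
    ∑ᶠ s : {s : CommutingTupleWithEnd r K V // IsNilpotent (s.1 0)},
      stableMoebius (Set.range s.1.1) = tupleMoebiusSum r K V := by
  rw [finsum_subtype_add_subtype_not (fun s => s.1.1 0 = 0)]
  have h1 : ∀ s : {s : {s : CommutingTupleWithEnd r K V // IsNilpotent (s.1 0)} // ¬ s.1.1 0 = 0},
      stableMoebius (Set.range s.1.1.1) = 0 := by
    rintro ⟨⟨s, hn⟩, h0⟩
    refine stableMoebius_eq_zero_of_isNilpotent hn h0 ?_ ?_
    · rintro _ ⟨i, rfl⟩
      exact s.2.2 _ _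
    · intro U hU u hu
      exact hU _ ⟨0, rfl⟩ hu
  simp only [h1, finsum_zero, add_zero]
  symm
  refine finsum_eq_of_bijective (fun t => ⟨⟨⟨Fin.cons 0 t.1, ?_, ?_⟩, ?_⟩, ?_⟩) ⟨?_, ?_⟩ ?_
  · intro i
    simpa using t.2.1 i
  · intro i j
    refine Fin.cases ?_ (fun i => ?_) i <;> refine Fin.cases ?_ (fun j => ?_) j
    · exact Commute.refl _
    · exact Commute.zero_left _
    · exact Commute.zero_right _
    · simpa using t.2.2 i j
  · exact IsNilpotent.zero
  · rfl
  · rintro ⟨t, ht⟩ ⟨t', ht'⟩ e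
    have e' := Subtype.ext_iff.1 (Subtype.ext_iff.1 (Subtype.ext_iff.1 e))
    simp only [Fin.cons_inj] at e'
    exact Subtype.ext e'.2
  · rintro ⟨⟨⟨s, hs⟩, hn⟩, h0⟩
    refine ⟨⟨Fin.tail s, hs.1, fun i j => hs.2 _ _⟩, ?_⟩
    refine Subtype.ext (Subtype.ext (Subtype.ext ?_))
    change Fin.cons 0 (Fin.tail s) = s
    rw [← show s 0 = 0 from h0, Fin.cons_self_tail]
  · intro t
    simp only [Fin.range_cons]
    exact (stableMoebius_of_mem_iff fun U => by simp [mem_stableSubmodules]).symm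

/-- Pairs of complementary subspaces. -/
abbrev ComplementaryPair (K V : Type*) [Field K] [AddCommGroup V] [Module K V] : Type _ :=
  {p : Submodule K V × Submodule K V // IsCompl p.1 p.2}

/-- With `mem_right_iff_exists_pow`, this recovers both summands from the endomorphism alone, giving
uniqueness of the Fitting decomposition. -/
theorem mem_left_iff_forall_pow {V₁ V₂ : Submodule K V} (h : IsCompl V₁ V₂)
    {f : Module.End K V₁ × Module.End K V₂} (h₁ : IsUnit f.1) (h₂ : IsNilpotent f.2) (v : V) :
    v ∈ V₁ ↔ ∀ n : ℕ, v ∈ LinearMap.range (blockSum h f ^ n) := by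
  constructor
  · intro hv n
    obtain ⟨w, hw⟩ := ((Module.End.isUnit_iff _).1 (h₁.pow n)).2 ⟨v, hv⟩
    refine ⟨w, ?_⟩
    rw [← map_pow, blockSum_apply_left, Prod.pow_fst, hw]
  · intro hv
    obtain ⟨n, hn⟩ := h₂
    obtain ⟨w, rfl⟩ := hv n
    obtain ⟨w, rfl⟩ := (V₁.prodEquivOfIsCompl V₂ h).surjective w
    rw [← map_pow, blockSum_apply]
    simp [hn]

theorem mem_right_iff_exists_pow {V₁ V₂ : Submodule K V} (h : IsCompl V₁ V₂)
    {f : Module.End K V₁ × Module.End K V₂} (h₁ : IsUnit f.1) (h₂ : IsNilpotent f.2) (v : V) :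
    v ∈ V₂ ↔ ∃ n : ℕ, (blockSum h f ^ n) v = 0 := by
  constructor
  · intro hv
    obtain ⟨n, hn⟩ := h₂
    refine ⟨n, ?_⟩
    rw [← map_pow, blockSum_apply_right h _ ⟨v, hv⟩, Prod.pow_snd, hn]
    simp
  · rintro ⟨n, hn⟩
    obtain ⟨w, rfl⟩ := (V₁.prodEquivOfIsCompl V₂ h).surjective v
    rw [← map_pow, blockSum_apply, LinearEquiv.map_eq_zero_iff, Prod.ext_iff] at hn
    have h0 : (f.1 ^ n) w.1 = 0 := hn.1
    have := injective_of_isUnit (h₁.pow n) (h0.trans (map_zero _).symm)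
    simp [this]

theorem exists_fitting_decomposition [Finite V] (φ : Module.End K V) :
    ∃ p : ComplementaryPair K V, (∀ f : Module.End K V, Commute f φ →
      (∀ v ∈ p.1.1, f v ∈ p.1.1) ∧ (∀ v ∈ p.1.2, f v ∈ p.1.2)) ∧
      ∃ (h₁ : ∀ v ∈ p.1.1, φ v ∈ p.1.1) (h₂ : ∀ v ∈ p.1.2, φ v ∈ p.1.2),
        IsUnit (φ.restrict h₁) ∧ IsNilpotent (φ.restrict h₂) := by
  -- The condition `n ≥ 1` ensures `ker φ ≤ ker (φ ^ n)`, whence `φ` is injective on the range of `φ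
  -- ^ n`.
  obtain ⟨n, hn, hn1⟩ := ((LinearMap.eventually_isCompl_ker_pow_range_pow φ).and
    (Filter.eventually_ge_atTop 1)).exists
  have hst : ∀ f : Module.End K V, Commute f φ →
      (∀ v ∈ LinearMap.range (φ ^ n), f v ∈ LinearMap.range (φ ^ n)) ∧
      (∀ v ∈ LinearMap.ker (φ ^ n), f v ∈ LinearMap.ker (φ ^ n)) := by
    intro f hf
    have hc := hf.pow_right n
    constructor
    · rintro _ ⟨v, rfl⟩
      exact ⟨f v, (LinearMap.congr_fun hc v).symm⟩
    · intro v hv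
      have := LinearMap.congr_fun hc v
      simp only [Module.End.mul_apply] at this
      rw [LinearMap.mem_ker] at hv ⊢
      rw [← this, hv, map_zero]
  have hker : ∀ w, φ w = 0 → w ∈ LinearMap.ker (φ ^ n) := by
    intro w hw
    obtain ⟨k, rfl⟩ : ∃ k, n = k + 1 := ⟨n - 1, by omega⟩
    rw [LinearMap.mem_ker, pow_succ, Module.End.mul_apply, hw, map_zero]
  refine ⟨⟨(LinearMap.range (φ ^ n), LinearMap.ker (φ ^ n)), hn.symm⟩, hst,
    (hst φ (Commute.refl φ)).1, (hst φ (Commute.refl φ)).2, ?_, n, ?_⟩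
  · refine isUnit_of_injective ((injective_iff_map_eq_zero _).2 fun v hv => Subtype.ext ?_)
    exact Submodule.disjoint_def.1 hn.disjoint _ (hker _ (congrArg Subtype.val hv)) v.2
  · refine LinearMap.ext fun v => Subtype.ext ?_
    rw [Module.End.pow_restrict]
    exact v.2

theorem exists_blockSum_eq [Finite V] {r : ℕ} (s : CommutingTupleWithEnd r K V) :
    ∃ (p : ComplementaryPair K V) (t : CommutingTuple (r + 1) K p.1.1)
      (u : CommutingTupleWithEnd r K p.1.2), IsNilpotent (u.1 0) ∧
      ∀ i, blockSum p.2 (t.1 i, u.1 i) = s.1 i := by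
  obtain ⟨s, hs⟩ := s
  obtain ⟨p, hp, h₁, h₂, hu, hn⟩ := exists_fitting_decomposition (s 0)
  have hx : ∀ i, ∃ x, blockSum p.2 x = s i := fun i =>
    ⟨_, blockSum_restrict p.2 (s i) (hp _ (hs.2 i 0)).1 (hp _ (hs.2 i 0)).2⟩
  choose x hx using hx
  have hx0 : x 0 = ((s 0).restrict h₁, (s 0).restrict h₂) :=
    blockSum_injective p.2 ((hx 0).trans (blockSum_restrict p.2 (s 0) h₁ h₂).symm)
  have hc : ∀ i j, Commute (x i).1 (x j).1 ∧ Commute (x i).2 (x j).2 := by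
    intro i j
    rw [← commute_blockSum_iff p.2, hx, hx]
    exact hs.2 i j
  have hunit : ∀ i : Fin r, IsUnit (x i.succ).1 ∧ IsUnit (x i.succ).2 := by
    intro i
    rw [← isUnit_blockSum_iff p.2, hx]
    exact hs.1 i
  have hu0 : IsUnit (x 0).1 := by rwa [hx0]
  have hn0 : IsNilpotent (x 0).2 := by rwa [hx0]
  exact ⟨p, ⟨fun i => (x i).1, Fin.cases hu0 fun i => (hunit i).1, fun i j => (hc i j).1⟩,
    ⟨fun i => (x i).2, fun i => (hunit i).2, fun i j => (hc i j).2⟩, hn0, hx⟩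

/-- Data for a tuple that is block diagonal with respect to some complementary pair, with first
entry the sum of an invertible and a nilpotent block. -/
abbrev FittingDatum (r : ℕ) (K V : Type*) [Field K] [AddCommGroup V] [Module K V] : Type _ :=
  Σ p : ComplementaryPair K V, CommutingTuple (r + 1) K p.1.1 ×
    {s : CommutingTupleWithEnd r K p.1.2 // IsNilpotent (s.1 0)}

/-- The block diagonal tuple attached to a datum. -/
noncomputable def FittingDatum.blockSum [Finite V] {r : ℕ} (q : FittingDatum r K V) :
    CommutingTupleWithEnd r K V :=
  ⟨fun i => _root_.blockSum q.1.2 (q.2.1.1 i, q.2.2.1.1 i),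
    fun _ => (isUnit_blockSum_iff _ _).2 ⟨q.2.1.2.1 _, q.2.2.1.2.1 _⟩,
    fun _ _ => (commute_blockSum_iff _ _ _).2 ⟨q.2.1.2.2 _ _, q.2.2.1.2.2 _ _⟩⟩

theorem FittingDatum.blockSum_bijective [Finite V] (r : ℕ) :
    Function.Bijective (FittingDatum.blockSum : FittingDatum r K V → _) := by
  constructor
  · rintro ⟨⟨⟨V₁, V₂⟩, h⟩, ⟨t, ht⟩, ⟨s, hs⟩, hn⟩ ⟨⟨⟨V₁', V₂'⟩, h'⟩, ⟨t', ht'⟩, ⟨s', hs'⟩, hn'⟩ e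
    have e1 : ∀ i, _root_.blockSum h (t i, s i) = _root_.blockSum h' (t' i, s' i) :=
      fun i => congrFun (Subtype.ext_iff.1 e) i
    have eV₁ : V₁ = V₁' := by
      ext v
      rw [mem_left_iff_forall_pow h (f := (t 0, s 0)) (ht.1 0) hn, e1,
        ← mem_left_iff_forall_pow h' (f := (t' 0, s' 0)) (ht'.1 0) hn']
    have eV₂ : V₂ = V₂' := by
      ext v
      rw [mem_right_iff_exists_pow h (f := (t 0, s 0)) (ht.1 0) hn, e1,
        ← mem_right_iff_exists_pow h' (f := (t' 0, s' 0)) (ht'.1 0) hn']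
    subst eV₁ eV₂
    have e2 : ∀ i, (t i, s i) = (t' i, s' i) := fun i => blockSum_injective h (e1 i)
    obtain rfl : t = t' := funext fun i => congrArg Prod.fst (e2 i)
    obtain rfl : s = s' := funext fun i => congrArg Prod.snd (e2 i)
    rfl
  · intro s
    obtain ⟨p, t, u, hn, h⟩ := exists_blockSum_eq s
    exact ⟨⟨p, t, ⟨u, hn⟩⟩, Subtype.ext (funext h)⟩

/-- The Fitting decomposition with respect to the first endomorphism. -/
theorem sum_commutingTupleWithEnd_eq_sum_complementaryPair [Finite V] (r : ℕ) :
    ∑ᶠ s : CommutingTupleWithEnd r K V, stableMoebius (Set.range s.1) =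
      ∑ᶠ p : ComplementaryPair K V,
        tupleMoebiusSum (r + 1) K p.1.1 * tupleMoebiusSum r K p.1.2 := by
  have h1 : ∀ p : ComplementaryPair K V,
      tupleMoebiusSum (r + 1) K p.1.1 * tupleMoebiusSum r K p.1.2 =
      ∑ᶠ a : CommutingTuple (r + 1) K p.1.1 ×
        {s : CommutingTupleWithEnd r K p.1.2 // IsNilpotent (s.1 0)},
        stableMoebius (Set.range a.1.1) * stableMoebius (Set.range a.2.1.1) := by
    intro p
    rw [← sum_commutingTupleWithEnd_nilpotent r, tupleMoebiusSum, finsum_mul_of_finite,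
      finsum_prod_of_finite]
    refine finsum_congr fun t => ?_
    rw [mul_finsum_of_finite]
  rw [finsum_congr h1, ← finsum_sigma_of_finite (fun q : FittingDatum r K V =>
    stableMoebius (Set.range q.2.1.1) * stableMoebius (Set.range q.2.2.1.1))]
  refine (finsum_eq_of_bijective _ (FittingDatum.blockSum_bijective r) ?_).symm
  rintro ⟨p, t, s, hn⟩
  exact (stableMoebius_blockSum p.2 (fun i => (t.1 i, s.1 i)) 0 (t.2.1 0) hn).symm

end FittingDecomposition

/-! ### Subspace lattices, general linear groups and complementary pairs -/

section DimensionCounting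

variable {K : Type*} [Field K]

theorem moebius_submodule_congr {V V' : Type*} [AddCommGroup V] [Module K V] [AddCommGroup V']
    [Module K V'] (e : V ≃ₗ[K] V') :
    moebius (⊥ : Submodule K V) ⊤ = moebius (⊥ : Submodule K V') ⊤ := by
  rw [← moebius_orderIso (Submodule.orderIsoMapComap e), map_bot, map_top]

theorem moebius_bot_top_of_finrank_eq_succ [Finite K] {V V' : Type*} [AddCommGroup V] [Module K V]
    [AddCommGroup V'] [Module K V'] [Finite V] [Finite V'] {n : ℕ}
    (hV : Module.finrank K V = n + 1) (hV' : Module.finrank K V' = n) :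
    moebius (⊥ : Submodule K V) ⊤ = - (Nat.card K : ℤ) ^ n * moebius (⊥ : Submodule K V') ⊤ := by
  have : Nontrivial V := Module.nontrivial_of_finrank_pos (R := K) (by omega)
  obtain ⟨H, hH, -⟩ := (eq_top_or_exists_le_coatom (⊥ : Submodule K V)).resolve_left bot_ne_top
  obtain ⟨X, hX⟩ := exists_isCompl H
  have hs : IsSimpleModule K X :=
    have := isSimpleModule_iff_isCoatom.2 hH
    IsSimpleModule.congr (Submodule.quotientEquivOfIsCompl H X hX).symm
  have hX1 : Module.finrank K X = 1 := isSimpleModule_iff_finrank_eq_one.1 hs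
  have hHn : Module.finrank K H = n := by
    have := Submodule.finrank_add_eq_of_isCompl hX
    omega
  have e : H ≃ₗ[K] V' := LinearEquiv.ofFinrankEq _ _ (hHn.trans hV'.symm)
  rw [moebius_bot_eq_neg_sum_complements hH (fun h => hH.1 (top_le_iff.1 h))]
  -- For each line `Y` complementary to `H`, the interval `[Y, ⊤]` is isomorphic to `[⊥, H]`; there
  -- are `|Hom(X, H)| = q^n` such lines.
  have h1 : ∀ Y : {Y : {Y : Submodule K V // IsCompl H Y} // Y.1 ≤ ⊤},
      moebius Y.1.1 ⊤ = moebius (⊥ : Submodule K V') ⊤ := by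
    intro Y
    rw [← moebius_submodule_congr e, moebius_bot_top_submodule,
      moebius_bot_eq_moebius_sup Y.1.2 le_rfl, Y.1.2.sup_eq_top]
  rw [finsum_congr h1, finsum_const_of_finite]
  have h2 : Nat.card {Y : {Y : Submodule K V // IsCompl H Y} // Y.1 ≤ ⊤} = Nat.card K ^ n := by
    rw [Nat.card_congr (Equiv.subtypeUnivEquiv fun _ => le_top), card_complements hX.symm,
      Module.natCard_eq_pow_finrank (K := K), Module.finrank_linearMap, hX1, hHn, one_mul]
  rw [h2, nsmul_eq_mul]
  push_cast
  ring

/-- The order of `GL_n(K)`. -/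
noncomputable def generalLinearCard (K : Type*) [Field K] (n : ℕ) : ℕ :=
  Nat.card ((Fin n → K) ≃ₗ[K] (Fin n → K))

theorem card_generalLinearGroup (n : ℕ) :
    Nat.card (LinearMap.GeneralLinearGroup K (Fin n → K)) = generalLinearCard K n :=
  Nat.card_congr (LinearMap.GeneralLinearGroup.generalLinearEquiv K (Fin n → K)).toEquiv

theorem generalLinearCard_pos [Finite K] (n : ℕ) : 0 < generalLinearCard K n := by
  have : Finite ((Fin n → K) ≃ₗ[K] (Fin n → K)) := DFunLike.finite _
  exact Nat.card_pos

theorem generalLinearCard_eq_prod [Finite K] (n : ℕ) :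
    generalLinearCard K n = ∏ i : Fin n, (Nat.card K ^ n - Nat.card K ^ (i : ℕ)) := by
  have := Fintype.ofFinite K
  rw [← card_generalLinearGroup, Nat.card_eq_fintype_card (α := K), ← Matrix.card_GL_field n]
  exact (Nat.card_congr Matrix.GeneralLinearGroup.toLin.toEquiv).symm

theorem generalLinearCard_succ [Finite K] (n : ℕ) :
    (generalLinearCard K (n + 1) : ℚ) =
      (Nat.card K : ℚ) ^ n * ((Nat.card K : ℚ) ^ (n + 1) - 1) * generalLinearCard K n := by
  have hq : 1 ≤ Nat.card K := Nat.card_pos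
  have hcast : ∀ m : ℕ, (generalLinearCard K m : ℚ) =
      ∏ i : Fin m, ((Nat.card K : ℚ) ^ m - (Nat.card K : ℚ) ^ (i : ℕ)) := by
    intro m
    rw [generalLinearCard_eq_prod, Nat.cast_prod]
    refine Finset.prod_congr rfl fun i _ => ?_
    rw [Nat.cast_sub (Nat.pow_le_pow_right hq i.2.le)]
    push_cast
    rfl
  rw [hcast, hcast, Fin.prod_univ_succ]
  have : ∀ i : Fin n, ((Nat.card K : ℚ) ^ (n + 1) - (Nat.card K : ℚ) ^ (i.succ : ℕ)) =
      (Nat.card K : ℚ) * ((Nat.card K : ℚ) ^ n - (Nat.card K : ℚ) ^ (i : ℕ)) := by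
    intro i
    rw [Fin.val_succ]
    ring
  simp only [this]
  rw [Finset.prod_mul_distrib, Finset.prod_const, Finset.card_univ, Fintype.card_fin]
  simp only [Fin.val_zero, pow_zero]
  ring

theorem card_linearEquiv_of_linearEquiv {V V' W W' : Type*} [AddCommGroup V] [Module K V]
    [AddCommGroup V'] [Module K V'] [AddCommGroup W] [Module K W] [AddCommGroup W'] [Module K W']
    (e : V ≃ₗ[K] V') (e' : W ≃ₗ[K] W') : Nat.card (V ≃ₗ[K] W) = Nat.card (V' ≃ₗ[K] W') :=
  Nat.card_congr
    { toFun := fun f => e.symm.trans (f.trans e')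
      invFun := fun f => e.trans (f.trans e'.symm)
      left_inv := fun f => by ext; simp
      right_inv := fun f => by ext; simp }

theorem card_linearEquiv_of_finrank_eq {V W : Type*} [AddCommGroup V] [Module K V]
    [AddCommGroup W] [Module K W] [Module.Finite K V] [Module.Finite K W] {n : ℕ}
    (hV : Module.finrank K V = n) (hW : Module.finrank K W = n) :
    Nat.card (V ≃ₗ[K] W) = generalLinearCard K n :=
  card_linearEquiv_of_linearEquiv (LinearEquiv.ofFinrankEq _ _ (by simpa using hV))
    (LinearEquiv.ofFinrankEq _ _ (by simpa using hW))

/-- The number of complementary pairs of prescribed dimensions. -/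
theorem card_complementaryPair_mul [Finite K] {V : Type*} [AddCommGroup V] [Module K V] [Finite V]
    {n a b : ℕ} (hV : Module.finrank K V = n) (hab : a + b = n) :
    Nat.card {p : ComplementaryPair K V //
      (Module.finrank K p.1.1, Module.finrank K p.1.2) = (a, b)} *
      (generalLinearCard K a * generalLinearCard K b) = generalLinearCard K n := by
  set P := {p : ComplementaryPair K V //
      (Module.finrank K p.1.1, Module.finrank K p.1.2) = (a, b)}
  have hfin : ∀ {V W : Type _} [AddCommGroup V] [Module K V] [AddCommGroup W] [Module K W]
    [Finite V] [Finite W], Finite (V ≃ₗ[K] W) := DFunLike.finite _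
  -- Isomorphisms `K^a × K^b ≃ V` are counted through the images of the two factors: a complementary
  -- pair together with a parametrisation of each member.
  have h1 : Nat.card (Σ p : P, ((Fin a → K) ≃ₗ[K] p.1.1.1) × ((Fin b → K) ≃ₗ[K] p.1.1.2)) =
      Nat.card P * (generalLinearCard K a * generalLinearCard K b) := by
    classical
    have := Fintype.ofFinite P
    rw [Nat.card_sigma, Nat.card_eq_fintype_card (α := P), ← Finset.card_univ, ← smul_eq_mul,
      ← Finset.sum_const]
    refine Finset.sum_congr rfl fun p _ => ?_
    have hp := Prod.ext_iff.1 p.2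
    rw [Nat.card_prod, card_linearEquiv_of_finrank_eq (n := a) (by simp) hp.1,
      card_linearEquiv_of_finrank_eq (n := b) (by simp) hp.2]
  rw [← h1, ← card_linearEquiv_of_finrank_eq (K := K) (V := (Fin a → K) × (Fin b → K)) (W := V)
    (n := n) (by simpa using hab) hV]
  refine Nat.card_eq_of_bijective
    (fun q => (q.2.1.prodCongr q.2.2).trans (Submodule.prodEquivOfIsCompl _ _ q.1.1.2)) ⟨?_, ?_⟩
  · rintro ⟨⟨⟨⟨V₁, V₂⟩, h⟩, hd⟩, e₁, e₂⟩ ⟨⟨⟨⟨V₁', V₂'⟩, h'⟩, hd'⟩, e₁', e₂'⟩ e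
    have e1 : ∀ x, (e₁ x : V) = e₁' x := fun x => by
      simpa using LinearEquiv.congr_fun e (x, 0)
    have e2 : ∀ y, (e₂ y : V) = e₂' y := fun y => by
      simpa using LinearEquiv.congr_fun e (0, y)
    have eV₁ : V₁ = V₁' := by
      ext v
      constructor
      · intro hv
        obtain ⟨x, hx⟩ := e₁.surjective ⟨v, hv⟩
        rw [show v = e₁' x by rw [← e1, hx]]
        exact (e₁' x).2
      · intro hv
        obtain ⟨x, hx⟩ := e₁'.surjective ⟨v, hv⟩
        rw [show v = e₁ x by rw [e1, hx]]
        exact (e₁ x).2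
    have eV₂ : V₂ = V₂' := by
      ext v
      constructor
      · intro hv
        obtain ⟨x, hx⟩ := e₂.surjective ⟨v, hv⟩
        rw [show v = e₂' x by rw [← e2, hx]]
        exact (e₂' x).2
      · intro hv
        obtain ⟨x, hx⟩ := e₂'.surjective ⟨v, hv⟩
        rw [show v = e₂ x by rw [e2, hx]]
        exact (e₂ x).2
    subst eV₁ eV₂
    obtain rfl : e₁ = e₁' := LinearEquiv.ext fun x => Subtype.ext (e1 x)
    obtain rfl : e₂ = e₂' := LinearEquiv.ext fun x => Subtype.ext (e2 x)
    rfl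
  · intro f
    let i₁ : (Fin a → K) →ₗ[K] V := f.toLinearMap ∘ₗ LinearMap.inl K _ _
    let i₂ : (Fin b → K) →ₗ[K] V := f.toLinearMap ∘ₗ LinearMap.inr K _ _
    have hi₁ : Function.Injective i₁ := f.injective.comp LinearMap.inl_injective
    have hi₂ : Function.Injective i₂ := f.injective.comp LinearMap.inr_injective
    have hc : IsCompl (LinearMap.range i₁) (LinearMap.range i₂) := by
      simp only [i₁, i₂, LinearMap.range_comp]
      exact (LinearMap.isCompl_range_inl_inr).map (Submodule.orderIsoMapComap f)
    refine ⟨⟨⟨⟨(LinearMap.range i₁, LinearMap.range i₂), hc⟩, ?_⟩,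
      LinearEquiv.ofInjective i₁ hi₁, LinearEquiv.ofInjective i₂ hi₂⟩, ?_⟩
    · rw [LinearMap.finrank_range_of_inj hi₁, LinearMap.finrank_range_of_inj hi₂]
      simp
    · refine LinearEquiv.ext fun ⟨x, y⟩ => ?_
      simp [i₁, i₂, ← map_add]

end DimensionCounting

/-! ### The recursion between generating functions -/

section Recursion

variable {K : Type*} [Field K]

theorem tupleMoebiusSum_congr (r : ℕ) {V V' : Type*} [AddCommGroup V] [Module K V]
    [AddCommGroup V'] [Module K V'] (e : V ≃ₗ[K] V') :
    tupleMoebiusSum r K V = tupleMoebiusSum r K V' := by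
  refine finsum_eq_of_bijective (fun t => ⟨fun i => e.conjRingEquiv (t.1 i),
    fun i => (t.2.1 i).map e.conjRingEquiv, fun i j => (t.2.2 i j).map e.conjRingEquiv⟩) ⟨?_, ?_⟩ ?_
  · intro t t' h
    exact Subtype.ext (funext fun i =>
      e.conjRingEquiv.injective (congrFun (Subtype.ext_iff.1 h) i))
  · intro t
    refine ⟨⟨fun i => e.conjRingEquiv.symm (t.1 i), fun i => (t.2.1 i).map e.conjRingEquiv.symm,
      fun i j => (t.2.2 i j).map e.conjRingEquiv.symm⟩, Subtype.ext (funext fun i => ?_)⟩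
    exact e.conjRingEquiv.apply_symm_apply _
  · intro t
    refine stableMoebius_congr e ?_ ?_
    · rintro _ ⟨i, rfl⟩
      exact ⟨_, ⟨i, rfl⟩, fun m => by simp⟩
    · rintro _ ⟨i, rfl⟩
      exact ⟨_, ⟨i, rfl⟩, fun m => by simp⟩

theorem tupleMoebiusSum_zero (V : Type*) [AddCommGroup V] [Module K V] :
    tupleMoebiusSum 0 K V = moebius (⊥ : Submodule K V) ⊤ := by
  have : Unique (CommutingTuple 0 K V) :=
    { default := ⟨Fin.elim0, fun i => i.elim0, fun i => i.elim0⟩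
      uniq := fun t => Subtype.ext (Subsingleton.elim _ _) }
  rw [tupleMoebiusSum, finsum_unique, Set.range_eq_empty, stableMoebius_empty]

/-- The normalised sum of Möbius invariants over commuting `r`-tuples in `GL_n(K)`. -/
noncomputable def normalizedMoebiusSum (K : Type*) [Field K] (r n : ℕ) : ℚ :=
  tupleMoebiusSum r K (Fin n → K) / generalLinearCard K n

theorem normalizedMoebiusSum_recursion [Finite K] (r n : ℕ) :
    (Nat.card K : ℚ) ^ n * normalizedMoebiusSum K r n =
      ∑ p ∈ Finset.HasAntidiagonal.antidiagonal n,
        normalizedMoebiusSum K (r + 1) p.1 * normalizedMoebiusSum K r p.2 := by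
  classical
  set V := Fin n → K
  have h1 := (sum_commutingTupleWithEnd (K := K) (V := V) r).symm.trans
    (sum_commutingTupleWithEnd_eq_sum_complementaryPair r)
  have := Fintype.ofFinite (ComplementaryPair K V)
  rw [finsum_eq_sum_of_fintype, ← Finset.sum_fiberwise_of_maps_to (s := Finset.univ)
    (t := Finset.HasAntidiagonal.antidiagonal n)
    (g := fun p : ComplementaryPair K V => (Module.finrank K p.1.1, Module.finrank K p.1.2))
    (fun p _ => by
      rw [Finset.HasAntidiagonal.mem_antidiagonal, Submodule.finrank_add_eq_of_isCompl p.2,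
        Module.finrank_fin_fun])] at h1
  have hcardV : Nat.card V = Nat.card K ^ n := by
    rw [Module.natCard_eq_pow_finrank (K := K), Module.finrank_fin_fun]
  have h2 : ∀ ab ∈ Finset.HasAntidiagonal.antidiagonal n,
      ((∑ p : ComplementaryPair K V with
        (Module.finrank K p.1.1, Module.finrank K p.1.2) = ab,
        tupleMoebiusSum (r + 1) K p.1.1 * tupleMoebiusSum r K p.1.2 : ℤ) : ℚ) =
      generalLinearCard K n *
        (normalizedMoebiusSum K (r + 1) ab.1 * normalizedMoebiusSum K r ab.2) := by
    rintro ⟨a, b⟩ hab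
    rw [Finset.HasAntidiagonal.mem_antidiagonal] at hab
    have hc : ∀ p ∈ Finset.univ.filter (fun p : ComplementaryPair K V =>
        (Module.finrank K p.1.1, Module.finrank K p.1.2) = (a, b)),
        tupleMoebiusSum (r + 1) K p.1.1 * tupleMoebiusSum r K p.1.2 =
        tupleMoebiusSum (r + 1) K (Fin a → K) * tupleMoebiusSum r K (Fin b → K) := by
      intro p hp
      have hp' := Prod.ext_iff.1 (Finset.mem_filter.1 hp).2
      rw [tupleMoebiusSum_congr (r + 1) (LinearEquiv.ofFinrankEq p.1.1 (Fin a → K)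
          (by simpa using hp'.1)),
        tupleMoebiusSum_congr r (LinearEquiv.ofFinrankEq p.1.2 (Fin b → K)
          (by simpa using hp'.2))]
    rw [Finset.sum_congr rfl hc, Finset.sum_const, ← card_complementaryPair_mul (K := K) (V := V)
      (a := a) (b := b) (Module.finrank_fin_fun K) hab, Nat.card_eq_fintype_card,
      Fintype.card_subtype, normalizedMoebiusSum, normalizedMoebiusSum]
    have ha : (generalLinearCard K a : ℚ) ≠ 0 := by exact_mod_cast (generalLinearCard_pos a).ne'
    have hb : (generalLinearCard K b : ℚ) ≠ 0 := by exact_mod_cast (generalLinearCard_pos b).ne'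
    rw [nsmul_eq_mul]
    push_cast
    field_simp
  have hn : (generalLinearCard K n : ℚ) ≠ 0 := by exact_mod_cast (generalLinearCard_pos n).ne'
  have h3 := congrArg (Int.cast : ℤ → ℚ) h1
  rw [Int.cast_sum, Finset.sum_congr rfl h2, ← Finset.mul_sum, hcardV] at h3
  push_cast at h3
  rw [normalizedMoebiusSum, ← mul_div_assoc, h3, mul_div_cancel_left₀ _ hn]

theorem normalizedMoebiusSum_zero_right [Finite K] (r : ℕ) : normalizedMoebiusSum K r 0 = 1 := by
  have hG : generalLinearCard K 0 = 1 := by simp [generalLinearCard_eq_prod]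
  have : Unique (CommutingTuple r K (Fin 0 → K)) :=
    { default := ⟨fun _ => 1, fun _ => isUnit_one, fun _ _ => Commute.refl _⟩
      uniq := fun t => Subtype.ext (Subsingleton.elim _ _) }
  rw [normalizedMoebiusSum, hG, tupleMoebiusSum, finsum_unique, stableMoebius_of_subsingleton]
  simp

/-- Coefficientwise form of `F_0(qx) = (1 - x) F_0(x)`. -/
theorem normalizedMoebiusSum_zero_left_succ [Finite K] (n : ℕ) :
    (Nat.card K : ℚ) ^ (n + 1) * normalizedMoebiusSum K 0 (n + 1) =
      normalizedMoebiusSum K 0 (n + 1) - normalizedMoebiusSum K 0 n := by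
  have hq : 1 < (Nat.card K : ℚ) := by exact_mod_cast Finite.one_lt_card
  have hn : (generalLinearCard K n : ℚ) ≠ 0 := by exact_mod_cast (generalLinearCard_pos n).ne'
  have h1 : (Nat.card K : ℚ) ^ (n + 1) - 1 ≠ 0 := by
    exact sub_ne_zero.2 (one_lt_pow₀ hq (Nat.succ_ne_zero n)).ne'
  have h2 : (Nat.card K : ℚ) ^ n ≠ 0 := pow_ne_zero _ (by linarith)
  rw [normalizedMoebiusSum, normalizedMoebiusSum, generalLinearCard_succ, tupleMoebiusSum_zero,
    tupleMoebiusSum_zero, moebius_bot_top_of_finrank_eq_succ (V' := Fin n → K) (n := n)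
      (by simp) (by simp)]
  push_cast
  field_simp
  ring

/-- The generating function of the normalised sums. -/
noncomputable def normalizedMoebiusSeries (K : Type*) [Field K] (r : ℕ) : PowerSeries ℚ :=
  PowerSeries.mk (normalizedMoebiusSum K r)

theorem normalizedMoebiusSeries_succ_mul [Finite K] (r : ℕ) :
    normalizedMoebiusSeries K (r + 1) * normalizedMoebiusSeries K r =
      PowerSeries.rescale (Nat.card K : ℚ) (normalizedMoebiusSeries K r) := by
  ext n
  rw [PowerSeries.coeff_mul, PowerSeries.coeff_rescale, normalizedMoebiusSeries,
    normalizedMoebiusSeries, PowerSeries.coeff_mk, normalizedMoebiusSum_recursion]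
  simp only [PowerSeries.coeff_mk]

theorem normalizedMoebiusSeries_ne_zero [Finite K] (r : ℕ) : normalizedMoebiusSeries K r ≠ 0 := by
  intro h
  have := congrArg (PowerSeries.coeff 0) h
  rw [normalizedMoebiusSeries, PowerSeries.coeff_mk, normalizedMoebiusSum_zero_right] at this
  simp at this

theorem normalizedMoebiusSeries_one [Finite K] :
    normalizedMoebiusSeries K 1 = 1 - PowerSeries.X := by
  -- Compare `F_1 F_0 = F_0(qx)` with `F_0(qx) = (1 - x) F_0` and cancel `F_0`.
  refine mul_right_cancel₀ (normalizedMoebiusSeries_ne_zero (K := K) 0) ?_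
  rw [normalizedMoebiusSeries_succ_mul 0]
  ext n
  rw [sub_mul, one_mul, PowerSeries.coeff_rescale, map_sub]
  rcases n with _ | n
  · simp
  · rw [PowerSeries.coeff_succ_X_mul, normalizedMoebiusSeries, PowerSeries.coeff_mk,
      PowerSeries.coeff_mk, normalizedMoebiusSum_zero_left_succ]

end Recursion

/-! ### Homomorphisms from `ℤ^r` as commuting tuples -/

section ChiTilde

variable {K : Type} [Field K]

theorem forall_smul_eq_iff_generators {r : ℕ} {G P : Type*} [Group G] [MulAction G P]
    (X : FreeAbelianRank r →* G) (p : P) :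
    (∀ z, X z • p = p) ↔ ∀ i, X (Pi.mulSingle i (Multiplicative.ofAdd 1)) • p = p := by
  refine ⟨fun h i => h _, fun h z => ?_⟩
  let S := (MulAction.stabilizer G p).comap X
  change z ∈ S
  rw [← Finset.univ_prod_mulSingle z]
  refine Subgroup.prod_mem _ fun i _ => ?_
  have : Pi.mulSingle i (z i) = (Pi.mulSingle i (Multiplicative.ofAdd 1) : FreeAbelianRank r) ^
      (Multiplicative.toAdd (z i)) := by
    rw [← Pi.mulSingle_zpow, ← ofAdd_zsmul]
    simp
  rw [this]
  exact Subgroup.zpow_mem _ (h i) _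

theorem exists_hom_apply_generators {r : ℕ} {G : Type*} [Group G] (u : Fin r → G)
    (hu : ∀ i j, Commute (u i) (u j)) :
    ∃ X : FreeAbelianRank r →* G, ∀ i, X (Pi.mulSingle i (Multiplicative.ofAdd 1)) = u i := by
  have hc : Pairwise fun i j => ∀ x y : Multiplicative ℤ,
      Commute (zpowersHom G (u i) x) (zpowersHom G (u j) y) := by
    intro i j _ x y
    rw [zpowersHom_apply, zpowersHom_apply]
    exact (hu i j).zpow_zpow _ _
  refine ⟨MonoidHom.noncommPiCoprod (fun i => zpowersHom G (u i)) hc, fun i => ?_⟩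
  refine (MonoidHom.noncommPiCoprod_mulSingle (fun i => zpowersHom G (u i)) (hcomm := hc) i _).trans ?_
  simp

/-- In finite dimension, `gU ≤ U` already forces equality because `g` preserves dimension. -/
theorem smul_properSubspace_eq_iff {V : Type*} [AddCommGroup V] [Module K V] [Finite V]
    (g : LinearMap.GeneralLinearGroup K V) (U : ProperSubspace K V) :
    g • U = U ↔ ∀ u ∈ U.1, (g : Module.End K V) u ∈ U.1 := by
  have hdef : (g • U).1 = U.1.map (g : V →ₗ[K] V) := rfl
  rw [Subtype.ext_iff, hdef]
  constructor
  · intro h u hu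
    rw [← h]
    exact ⟨u, hu, rfl⟩
  · intro h
    refine Submodule.eq_of_le_of_finrank_eq (Submodule.map_le_iff_le_comap.2 h) ?_
    exact LinearEquiv.finrank_map_eq (LinearMap.GeneralLinearGroup.toLinearEquiv g) U.1

theorem reducedEulerChar_fixedSubposet {r : ℕ} {V : Type*} [AddCommGroup V] [Module K V] [Finite V]
    [Nontrivial V] (X : FreeAbelianRank r →* LinearMap.GeneralLinearGroup K V) :
    reducedEulerChar (FixedSubposet (ProperSubspace K V) X) =
      stableMoebius (Set.range fun i : Fin r =>
        (X (Pi.mulSingle i (Multiplicative.ofAdd 1)) : Module.End K V)) := by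
  set T := Set.range fun i : Fin r =>
        (X (Pi.mulSingle i (Multiplicative.ofAdd 1)) : Module.End K V) with hT
  have hne : (⊥ : stableSubmodules T) ≠ ⊤ := fun h =>
    bot_ne_top (α := Submodule K V) (congrArg Subtype.val h)
  have hmem : ∀ U : ProperSubspace K V, (∀ z, X z • U = U) ↔ U.1 ∈ stableSubmodules T := by
    intro U
    rw [forall_smul_eq_iff_generators, mem_stableSubmodules, hT, Set.forall_mem_range]
    exact forall_congr' fun i => smul_properSubspace_eq_iff _ _
  rw [stableMoebius, moebius_of_ne hne]
  refine reducedEulerChar_orderIso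
    { toFun := fun U => ⟨⟨U.1.1, (hmem U.1).1 U.2⟩,
        bot_lt_iff_ne_bot.2 fun h => U.1.2.1 (congrArg Subtype.val h),
        lt_top_iff_ne_top.2 fun h => U.1.2.2 (congrArg Subtype.val h)⟩
      invFun := fun U => ⟨⟨U.1.1, fun h => U.2.1.ne' (Subtype.ext h),
        fun h => U.2.2.ne (Subtype.ext h)⟩, (hmem _).2 U.1.2⟩
      left_inv := fun _ => rfl
      right_inv := fun _ => rfl
      map_rel_iff' := Iff.rfl }

/-- The case `n = 0` is a genuine exception: the empty poset has reduced Euler characteristic `-1`,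
while the Möbius invariant of the one-point lattice is `1`. -/
theorem chiTilde_eq_normalizedMoebiusSum [Finite K] (r : ℕ) {n : ℕ} (hn : 1 ≤ n) :
    chiTilde r n K = normalizedMoebiusSum K r n := by
  have : Nonempty (Fin n) := ⟨⟨0, hn⟩⟩
  set V := Fin n → K
  rw [chiTilde, equivariantReducedEulerChar, card_generalLinearGroup, normalizedMoebiusSum,
    one_div, div_eq_inv_mul]
  congr 1
  rw [tupleMoebiusSum]
  have hcast : ((∑ᶠ t : CommutingTuple r K V, stableMoebius (Set.range t.1) : ℤ) : ℚ) =
      ∑ᶠ t : CommutingTuple r K V, (stableMoebius (Set.range t.1) : ℚ) :=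
    AddMonoidHom.map_finsum (Int.castAddHom ℚ) (Set.toFinite _)
  rw [hcast]
  refine finsum_eq_of_bijective
    (fun X => ⟨fun i => (X (Pi.mulSingle i (Multiplicative.ofAdd 1)) : Module.End K V),
      fun i => Units.isUnit _, fun i j => ?_⟩) ⟨?_, ?_⟩ ?_
  · exact ((Commute.all (Pi.mulSingle i (Multiplicative.ofAdd 1) : FreeAbelianRank r)
      (Pi.mulSingle j (Multiplicative.ofAdd 1))).map X).units_val
  · intro X Y h
    have h' : ∀ i, X (Pi.mulSingle i (Multiplicative.ofAdd 1)) =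
        Y (Pi.mulSingle i (Multiplicative.ofAdd 1)) := fun i =>
      Units.ext (congrFun (Subtype.ext_iff.1 h) i)
    exact MonoidHom.pi_ext fun i z => DFunLike.congr_fun (MonoidHom.ext_mint
        (f := X.comp (MonoidHom.mulSingle (fun _ : Fin r => Multiplicative ℤ) i))
        (g := Y.comp (MonoidHom.mulSingle (fun _ : Fin r => Multiplicative ℤ) i)) (h' i)) z
  · rintro ⟨t, ht, hc⟩
    choose u hu using fun i => ht i
    have hcu : ∀ i j, Commute (u i) (u j) := fun i j =>
      Commute.units_of_val (by rw [hu, hu]; exact hc i j)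
    obtain ⟨X, hX⟩ := exists_hom_apply_generators (G := LinearMap.GeneralLinearGroup K V) u hcu
    exact ⟨X, Subtype.ext (funext fun i => (congrArg Units.val (hX i)).trans (hu i))⟩
  · intro X
    rw [reducedEulerChar_fixedSubposet]

end ChiTilde

/-! ### The series over `ℤ[q]`: specialisation, divisibility, uniqueness -/

section PolynomialSeries

open Polynomial in
/-- The series `F_{k+1}`, defined by `F_1 = 1 - x` and `F_{k+1}(x) = F_k(q x) / F_k(x)`. -/
noncomputable def chiSeries : ℕ → PowerSeries ℤ[X]
  | 0 => 1 - PowerSeries.X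
  | k + 1 => PowerSeries.rescale X (chiSeries k) * PowerSeries.invOfUnit (chiSeries k) 1

theorem constantCoeff_chiSeries (k : ℕ) : PowerSeries.constantCoeff (chiSeries k) = 1 := by
  induction k with
  | zero => simp [chiSeries]
  | succ k ih =>
    rw [chiSeries, map_mul, PowerSeries.constantCoeff_invOfUnit]
    rw [← PowerSeries.coeff_zero_eq_constantCoeff_apply] at ih ⊢
    simp [PowerSeries.coeff_rescale, ih]

theorem chiSeries_succ_mul (k : ℕ) :
    chiSeries (k + 1) * chiSeries k = PowerSeries.rescale Polynomial.X (chiSeries k) := by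
  rw [chiSeries, mul_assoc, mul_comm (PowerSeries.invOfUnit _ _),
    PowerSeries.mul_invOfUnit _ _ (by rw [constantCoeff_chiSeries]; rfl), mul_one]

/-- Write `F = 1 + (q - 1)^k G`. Then `F(qx) - F(x) = (q - 1)^k (G(qx) - G(x))`, and the
coefficients of the last factor are multiples of `q^n - 1`, hence of `q - 1`. -/
theorem pow_dvd_chiSeries_sub_one (k : ℕ) :
    PowerSeries.C ((Polynomial.X - 1 : Polynomial ℤ) ^ k) ∣ chiSeries k - 1 := by
  induction k with
  | zero => simp
  | succ k ih =>
    obtain ⟨G, hG⟩ := ih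
    have h1 : chiSeries (k + 1) - 1 =
        (PowerSeries.rescale Polynomial.X (chiSeries k) - chiSeries k) *
          PowerSeries.invOfUnit (chiSeries k) 1 := by
      rw [sub_mul, PowerSeries.mul_invOfUnit _ _ (by rw [constantCoeff_chiSeries]; rfl)]
      rfl
    have h2 : PowerSeries.C (Polynomial.X - 1 : Polynomial ℤ) ∣
        PowerSeries.rescale Polynomial.X G - G := by
      have : ∀ n, ∃ c, PowerSeries.coeff n (PowerSeries.rescale Polynomial.X G - G) =
          (Polynomial.X - 1 : Polynomial ℤ) * c := by
        intro n
        rw [map_sub, PowerSeries.coeff_rescale, ← sub_one_mul]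
        exact (sub_one_dvd_pow_sub_one _ n).mul_right _
      choose c hc using this
      refine ⟨PowerSeries.mk c, PowerSeries.ext fun n => ?_⟩
      rw [hc, PowerSeries.coeff_C_mul, PowerSeries.coeff_mk]
    have h3 : PowerSeries.rescale Polynomial.X (chiSeries k) - chiSeries k =
        PowerSeries.C ((Polynomial.X - 1 : Polynomial ℤ) ^ k) *
          (PowerSeries.rescale Polynomial.X G - G) := by
      have h4 : chiSeries k = 1 + PowerSeries.C ((Polynomial.X - 1 : Polynomial ℤ) ^ k) * G := by
        rw [← hG]; ring
      have h5 : PowerSeries.rescale Polynomial.X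
          (PowerSeries.C ((Polynomial.X - 1 : Polynomial ℤ) ^ k)) =
          PowerSeries.C ((Polynomial.X - 1 : Polynomial ℤ) ^ k) := by
        ext n : 1
        rw [PowerSeries.coeff_rescale, PowerSeries.coeff_C]
        split_ifs with h
        · simp [h]
        · simp
      rw [h4, map_add, map_mul, map_one, h5]
      ring
    rw [h1, h3, pow_succ, map_mul, mul_assoc]
    exact mul_dvd_mul_left _ (h2.mul_right _)

/-- Both families start from `1 - x` and satisfy the same recursion, which determines the next
series because the current one is nonzero over a field. -/
theorem map_chiSeries (K : Type*) [Field K] [Finite K] (k : ℕ) :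
    PowerSeries.map ((Int.castRingHom ℚ).comp (Polynomial.evalRingHom (Nat.card K : ℤ)))
      (chiSeries k) = normalizedMoebiusSeries K (k + 1) := by
  set φ := (Int.castRingHom ℚ).comp (Polynomial.evalRingHom (Nat.card K : ℤ)) with hφ
  induction k with
  | zero => simp [chiSeries, normalizedMoebiusSeries_one]
  | succ k ih =>
    refine mul_right_cancel₀ (normalizedMoebiusSeries_ne_zero (K := K) (k + 1)) ?_
    rw [normalizedMoebiusSeries_succ_mul, ← ih, ← map_mul, chiSeries_succ_mul]
    ext n
    simp [PowerSeries.coeff_rescale, hφ]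

theorem isChiGeneratingFunction_chiSeries (k : ℕ) :
    IsChiGeneratingFunction (k + 1) (chiSeries k) := by
  refine ⟨?_, fun n hn K _ _ => ?_⟩
  · rw [PowerSeries.coeff_zero_eq_constantCoeff_apply, constantCoeff_chiSeries]
  · rw [chiTilde_eq_normalizedMoebiusSum _ hn]
    have := congrArg (PowerSeries.coeff n) (map_chiSeries K k)
    rw [PowerSeries.coeff_map, normalizedMoebiusSeries, PowerSeries.coeff_mk] at this
    exact this

theorem IsChiGeneratingFunction.unique {r : ℕ} {F G : PowerSeries (Polynomial ℤ)}
    (hF : IsChiGeneratingFunction r F) (hG : IsChiGeneratingFunction r G) : F = G := by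
  ext1 n
  rcases Nat.eq_zero_or_pos n with rfl | hn
  · rw [hF.1, hG.1]
  · refine Polynomial.eq_of_infinite_eval_eq _ _ ?_
    -- The prime fields suffice: the two coefficients agree at infinitely many integers.
    refine (Nat.infinite_setOfPred_prime.image (Nat.cast_injective (R := ℤ)).injOn).mono ?_
    rintro _ ⟨p, hp, rfl⟩
    have : Fact p.Prime := ⟨hp⟩
    have h := (hF.2 n hn (ZMod p)).trans (hG.2 n hn (ZMod p)).symm
    rw [Nat.card_zmod] at h
    exact_mod_cast h

end PolynomialSeries

/-! ### Existence, uniqueness and divisibility combined -/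

theorem mainTheorem5 (r : ℕ) (hr : 1 ≤ r) :
    (∃! F : PowerSeries (Polynomial ℤ), IsChiGeneratingFunction r F) ∧
      ∀ F : PowerSeries (Polynomial ℤ), IsChiGeneratingFunction r F →
        PowerSeries.C ((Polynomial.X - 1 : Polynomial ℤ) ^ (r - 1)) ∣ F - 1 ∧
          ∀ n : ℕ, 1 ≤ n →
            (Polynomial.X - 1 : Polynomial ℤ) ^ (r - 1) ∣ PowerSeries.coeff n F := by
  obtain ⟨k, rfl⟩ : ∃ k, r = k + 1 := ⟨r - 1, by omega⟩
  have hk := isChiGeneratingFunction_chiSeries k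
  refine ⟨⟨chiSeries k, hk, fun F hF => hF.unique hk⟩, fun F hF => ?_⟩
  obtain rfl := hF.unique hk
  have hdvd := pow_dvd_chiSeries_sub_one k
  refine ⟨hdvd, fun n hn => ?_⟩
  obtain ⟨G, hG⟩ := hdvd
  have h := congrArg (PowerSeries.coeff n) hG
  rw [map_sub, PowerSeries.coeff_C_mul, PowerSeries.coeff_one, if_neg (by omega), sub_zero] at h
  exact ⟨_, h⟩
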